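/- **Theorem 5.5.** Let $G$ be a (finite-dimensional, real) Lie group, $H\subset G$ a subgroup such that $G/H$ is a smooth coset space, i.e. $G/H$, with the quotient topology, carries a smooth structure for which $\pi:G\to G/H$, $\pi(g)=g\cdot o$, $o=eH$, is a smooth submersion (so $H$ is closed). Let $\mathfrak g=\mathfrak h+\mathfrak m$ be a reductive decomposition: $\mathfrak g=\mathrm{Lie}(G)$, $\mathfrak h=\mathrm{Lie}(H)$, $\mathfrak m$ is a linear complement of $\mathfrak h$ and $\mathrm{Ad}(H)\mathfrak m\subset\mathfrak m$. Identify $\mathfrak m$ with $T_o(G/H)$ by $\pi_*$. A *spray structure* on a manifold $M$ is a smooth vector field $\mathbf G$ on $TM\setminus 0$ which in every standard local coordinate system $(x^i,y^j)$ has the form $y^i\partial_{x^i}-2\mathbf G^i\partial_{y^i}$ with $\mathbf G^i(x,\lambda y)=\lambda^2\mathbf G^i(x,y)$ for $\lambda>0$; its *geodesics* are the smooth curves $c$ with $\dot c\neq0$ everywhere such that $(c,\dot c)$ is an integral curve of $\mathbf G$. Given a $G$-invariant spray structure $\mathbf G$ on $G/H$ and $y\in\mathfrak m\setminus\{0\}$,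 let $c$ be the geodesic with $c(0)=o$, $\dot c(0)=y$, and let $\bar c$ be its lift to $G$ near $t=0$ with $\bar c(0)=e$, $\pi\circ\bar c=c$ and $y(t)=(L_{\bar c(t)^{-1}})_*\dot{\bar c}(t)\in\mathfrak m\setminus\{0\}$. The *spray vector field* of $\mathbf G$ is the map $\eta:\mathfrak m\setminus\{0\}\to\mathfrak m$, $\eta(y)=-\frac{d}{dt}\big|_{t=0}y(t)$. 1. For every $G$-invariant spray structure on $G/H$ the spray vector field is well defined: such $c$ and $\bar c$ exist for every $y\in\mathfrak m\setminus\{0\}$, and $\frac{d}{dt}|_{t=0}y(t)$ exists and does not depend on their choice. Sending a spray structure to its spray vector field is a bijection from the set of $G$-invariant spray structures on $G/H$ onto the set of smooth maps $\eta:\mathfrak m\setminus\{0\}\to\mathfrak m$ that are positively 2-homogeneous ($\eta(\lambda y)=\lambda^2\eta(y)$ for $\lambda>0$) and $\mathrm{Ad}(H)$-invariant ($\eta(\mathrm{Ad}(h)y)=\mathrm{Ad}(h)\eta(y)$ for $h\in H$). 2. The Nomizu connection of the reductive decomposition, i.e. the affine connection on $G/H$ given by $$\nabla_{\pi_*(L_g)_*\xi}Y=g_*\Big(d\big(g'\mapsto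 (g'^{-1})_*Y(g'\cdot o)\big)\big((L_g)_*\xi\big)\Big)\qquad(g\in G,\ \xi\in\mathfrak m),$$ exists. There is exactly one spray structure $\mathbf G_0$ on $G/H$ that is its geodesic spray, i.e. in standard local coordinates, with Christoffel symbols $\Gamma^i_{jk}$ of $\nabla$, $\mathbf G_0=y^i\partial_{x^i}-\Gamma^i_{jk}(x)y^jy^k\partial_{y^i}$. This $\mathbf G_0$ is $G$-invariant and its spray vector field is $0$. Every $G$-invariant spray structure $\mathbf G$ on $G/H$ can be written in exactly one way as $\mathbf G=\mathbf G_0-\mathbf H$ with a $G$-invariant smooth vector field $\mathbf H$ on $T(G/H)\setminus0$ tangent to each $T_x(G/H)$. Moreover, the restriction of $\mathbf H$ to $T_o(G/H)\setminus\{0\}=\mathfrak m\setminus\{0\}$ is the spray vector field of $\mathbf G$, and $\mathbf H$ is the only $G$-invariant smooth vector field on $T(G/H)\setminus0$ tangent to each $T_x(G/H)$ with this restriction. -/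

import Mathlib

open scoped Manifold ContDiff

noncomputable section

namespace SprayGeometry

/-! ### Spray structures on a smooth manifold

`M` is a smooth manifold modelled on the vector space `F`.  Vector fields on the slit tangent
bundle are encoded as functions on the whole tangent bundle which take the (meaningless) value
zero on the zero section, so that equality of two such functions is equality of the fields on the
slit tangent bundle. -/

section Sprays

variable {F M : Type*} [NormedAddCommGroup F] [NormedSpace ℝ F]
  [TopologicalSpace M] [ChartedSpace F M] [IsManifold 𝓘(ℝ, F) ∞ M]

variable (F M) in
/-- The slit tangent bundle, as a subset of the tangent bundle. -/
def slit : Set (TangentBundle 𝓘(ℝ, F) M) := {p | p.2 ≠ 0}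

variable (F M) in
/-- Assignments of a tangent vector of the tangent bundle to each of its points. -/
abbrev TangentBundleField : Type _ :=
  ∀ p : TangentBundle 𝓘(ℝ, F) M, TangentSpace 𝓘(ℝ, F).tangent p

/-- Smooth vector fields on the slit tangent bundle (extended by zero to the zero section). -/
structure IsSlitField (W : TangentBundleField F M) : Prop where
  smooth : ContMDiffOn 𝓘(ℝ, F).tangent 𝓘(ℝ, F).tangent.tangent ∞
    (fun p ↦ (⟨p, W p⟩ : TangentBundle 𝓘(ℝ, F).tangent (TangentBundle 𝓘(ℝ, F) M))) (slit F M)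
  zero_off : ∀ p, p ∉ slit F M → W p = 0

/-- The standard local coordinates `(x, y)` on the tangent bundle induced by a chart `e`. -/
def stdCoord (e : OpenPartialHomeomorph M F) (p : TangentBundle 𝓘(ℝ, F) M) : F × F :=
  (e p.1, mfderiv 𝓘(ℝ, F) 𝓘(ℝ, F) e p.1 p.2)

/-- The components of a tangent vector `w` of the tangent bundle in the coordinate frame
`∂_x, ∂_y` of the standard local coordinates induced by `e`. -/
def stdComponents (e : OpenPartialHomeomorph M F) (p : TangentBundle 𝓘(ℝ, F) M)
    (w : TangentSpace 𝓘(ℝ, F).tangent p) : F × F :=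
  mfderiv 𝓘(ℝ, F).tangent 𝓘(ℝ, F × F) (stdCoord e) p w

/-- Spray structures: smooth vector fields on the slit tangent bundle which, in any standard local
coordinates, are of the form `y ∂_x - 2 C(x, y) ∂_y` with `C` positively 2-homogeneous in `y`. -/
structure IsSpray (W : TangentBundleField F M) : Prop extends IsSlitField W where
  local_form : ∀ e ∈ IsManifold.maximalAtlas 𝓘(ℝ, F) ∞ M, ∃ C : F → F → F,
    (∀ p ∈ slit F M, p.1 ∈ e.source →
      stdComponents e p (W p) =
        ((stdCoord e p).2, -((2 : ℝ) • C (stdCoord e p).1 (stdCoord e p).2))) ∧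
    (∀ x ∈ e.target, ∀ y : F, y ≠ 0 → ∀ r : ℝ, 0 < r → C x (r • y) = r ^ 2 • C x y)

/-- The velocity lift of a curve to the tangent bundle. -/
def velocity (c : ℝ → M) (t : ℝ) : TangentBundle 𝓘(ℝ, F) M :=
  ⟨c t, mfderiv 𝓘(ℝ, ℝ) 𝓘(ℝ, F) c t (1 : ℝ)⟩

/-- Geodesics of `W` on an open set `s` of parameters: smooth curves with nowhere vanishing
velocity whose velocity lift is an integral curve of `W`. -/
structure IsGeodesicOn (W : TangentBundleField F M) (c : ℝ → M) (s : Set ℝ) : Prop where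
  smooth : ContMDiffOn 𝓘(ℝ, ℝ) 𝓘(ℝ, F) ∞ c s
  velocity_mem : ∀ t ∈ s, (velocity c t : TangentBundle 𝓘(ℝ, F) M) ∈ slit F M
  integral : IsMIntegralCurveOn (velocity c) W s

variable (Γ : Type*) [Group Γ] [MulAction Γ M] in
/-- Invariance `(g_*)_* W = W` of a field on the slit tangent bundle under a group action. -/
def IsInvariantField (W : TangentBundleField F M) : Prop :=
  ∀ g : Γ, ∀ p ∈ slit F M,
    mfderiv 𝓘(ℝ, F).tangent 𝓘(ℝ, F).tangent
      (tangentMap 𝓘(ℝ, F) 𝓘(ℝ, F) (fun x : M ↦ g • x)) p (W p) =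
    W (tangentMap 𝓘(ℝ, F) 𝓘(ℝ, F) (fun x : M ↦ g • x) p)

/-- The vertical lift of `w ∈ T_x M` at `p ∈ T_x M`: the velocity at `0` of `t ↦ p + t w`. -/
def verticalLift (p : TangentBundle 𝓘(ℝ, F) M) (w : TangentSpace 𝓘(ℝ, F) p.1) :
    TangentSpace 𝓘(ℝ, F).tangent p :=
  mfderiv 𝓘(ℝ, ℝ) 𝓘(ℝ, F).tangent
    (fun t : ℝ ↦ (⟨p.1, p.2 + t • w⟩ : TangentBundle 𝓘(ℝ, F) M)) 0 (1 : ℝ)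

/-- Smooth vector fields on the slit tangent bundle which are tangent to each `T_x M`. -/
structure IsVerticalField (V : TangentBundleField F M) : Prop extends IsSlitField V where
  vertical : ∀ p ∈ slit F M, ∃ w : TangentSpace 𝓘(ℝ, F) p.1, V p = verticalLift p w

/-- `W` is the geodesic spray of the affine connection `D`: at `v = Y x` it is the horizontal lift
of `v`, i.e. the image of `v` under the differential of the vector field `Y`, minus the vertical
lift of `D_v Y`.  In standard coordinates this is `y ∂_x - Γ(y, y) ∂_y`. Here `D Y x v` is `D_v Y`
at `x`. -/
def IsGeodesicSprayOf
    (D : CovariantDerivative 𝓘(ℝ, F) F (TangentSpace 𝓘(ℝ, F) : M → Type _))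
    (W : TangentBundleField F M) : Prop :=
  ∀ (Y : ∀ x : M, TangentSpace 𝓘(ℝ, F) x) (x : M),
    MDifferentiableAt 𝓘(ℝ, F) 𝓘(ℝ, F).tangent
      (fun z ↦ (⟨z, Y z⟩ : TangentBundle 𝓘(ℝ, F) M)) x → Y x ≠ 0 →
    W ⟨x, Y x⟩ =
      mfderiv 𝓘(ℝ, F) 𝓘(ℝ, F).tangent
        (fun z ↦ (⟨z, Y z⟩ : TangentBundle 𝓘(ℝ, F) M)) x (Y x)
      - verticalLift ⟨x, Y x⟩ (D Y x (Y x))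

end Sprays

/-! ### Coset spaces of a Lie group

`G` is a Lie group modelled on `E`, with Lie algebra `GroupLieAlgebra 𝓘(ℝ, E) G = T_1 G`. -/

section LieGroups

variable {E G : Type*} [NormedAddCommGroup E] [NormedSpace ℝ E]
  [TopologicalSpace G] [ChartedSpace E G] [Group G]

/-- The tangent space `T_1 G` is by definition the model space `E`; we give it the same norm. -/
instance instNormedAddCommGroupLieAlgebra : NormedAddCommGroup (GroupLieAlgebra 𝓘(ℝ, E) G) :=
  inferInstanceAs (NormedAddCommGroup E)

instance instNormedSpaceLieAlgebra : NormedSpace ℝ (GroupLieAlgebra 𝓘(ℝ, E) G) :=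
  inferInstanceAs (NormedSpace ℝ E)

/-- The adjoint representation: the differential of `x ↦ g x g⁻¹` at the identity. -/
def Ad (g : G) (v : GroupLieAlgebra 𝓘(ℝ, E) G) : GroupLieAlgebra 𝓘(ℝ, E) G :=
  mfderiv 𝓘(ℝ, E) 𝓘(ℝ, E) (fun x : G ↦ g * x * g⁻¹) 1 v

/-- The left translation `(L_{γ(t)⁻¹})_* γ'(t)` of the velocity of a curve in `G` to the
identity. -/
def leftVelocity (γ : ℝ → G) (t : ℝ) : GroupLieAlgebra 𝓘(ℝ, E) G :=
  mfderiv 𝓘(ℝ, E) 𝓘(ℝ, E) (fun x : G ↦ (γ t)⁻¹ * x) (γ t)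
    (mfderiv 𝓘(ℝ, ℝ) 𝓘(ℝ, E) γ t (1 : ℝ))

/-- `v` is the initial velocity of a smooth curve in the subgroup `H` starting at the identity. -/
def IsSubgroupVelocity (H : Subgroup G) (v : GroupLieAlgebra 𝓘(ℝ, E) G) : Prop :=
  ∃ γ : ℝ → G, ContMDiff 𝓘(ℝ, ℝ) 𝓘(ℝ, E) ∞ γ ∧ γ 0 = 1 ∧ (∀ t, γ t ∈ H) ∧
    mfderiv 𝓘(ℝ, ℝ) 𝓘(ℝ, E) γ 0 (1 : ℝ) = v

/-- The initial velocity of a reparametrized curve. -/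
theorem mfderiv_comp_mul_curve {E G : Type*} [NormedAddCommGroup E] [NormedSpace ℝ E]
    [TopologicalSpace G] [ChartedSpace E G] {γ : ℝ → G} (a : ℝ) {L : ℝ →L[ℝ] E}
    (hγ : HasMFDerivAt 𝓘(ℝ, ℝ) 𝓘(ℝ, E) γ 0 L) :
    HasMFDerivAt 𝓘(ℝ, ℝ) 𝓘(ℝ, E) (fun t : ℝ ↦ γ (a * t)) 0 (a • L) := by
  have h1 : HasMFDerivAt 𝓘(ℝ, ℝ) 𝓘(ℝ, ℝ) (fun t : ℝ ↦ a * t) 0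
      (a • ContinuousLinearMap.id ℝ ℝ) :=
    ((hasFDerivAt_id (0 : ℝ)).const_mul a).hasMFDerivAt
  have h2 : HasMFDerivAt 𝓘(ℝ, ℝ) 𝓘(ℝ, E) γ (a * 0) L := by
    rw [mul_zero]; exact hγ
  have h3 : L.comp (a • ContinuousLinearMap.id ℝ ℝ) = a • L := by ext; simp
  have h4 := h2.comp (0 : ℝ) h1
  exact h3 ▸ h4

/-- The initial velocity of a product of two curves through the identity. -/
theorem mfderiv_mul_curves [LieGroup 𝓘(ℝ, E) ∞ G] {γ δ : ℝ → G} {L L' : ℝ →L[ℝ] E}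
    (hγ : HasMFDerivAt 𝓘(ℝ, ℝ) 𝓘(ℝ, E) γ 0 L) (hδ : HasMFDerivAt 𝓘(ℝ, ℝ) 𝓘(ℝ, E) δ 0 L')
    (hγ0 : γ 0 = 1) (hδ0 : δ 0 = 1) :
    HasMFDerivAt 𝓘(ℝ, ℝ) 𝓘(ℝ, E) (fun t : ℝ ↦ γ t * δ t) 0 (L + L') := by
  have hm : MDifferentiableAt (𝓘(ℝ, E).prod 𝓘(ℝ, E)) 𝓘(ℝ, E) (fun p : G × G ↦ p.1 * p.2)
      (1, 1) := (contMDiff_mul 𝓘(ℝ, E) ∞).mdifferentiable (by simp) _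
  have hm' : HasMFDerivAt (𝓘(ℝ, E).prod 𝓘(ℝ, E)) 𝓘(ℝ, E) (fun p : G × G ↦ p.1 * p.2)
      (1, 1) (ContinuousLinearMap.fst ℝ E E + ContinuousLinearMap.snd ℝ E E) := by
    have e1 : (fun z : G ↦ z * 1) = id := by ext; simp
    have e2 : (fun z : G ↦ 1 * z) = id := by ext; simp
    have k1 : mfderiv 𝓘(ℝ, E) 𝓘(ℝ, E) (fun z : G ↦ z * 1) 1 = ContinuousLinearMap.id ℝ E := by
      rw [e1]; exact mfderiv_id
    have k2 : mfderiv 𝓘(ℝ, E) 𝓘(ℝ, E) (fun z : G ↦ 1 * z) 1 = ContinuousLinearMap.id ℝ E := by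
      rw [e2]; exact mfderiv_id
    have h := hm.hasMFDerivAt
    rw [mfderiv_prod_eq_add_comp hm] at h
    have aux : ∀ A B : E →L[ℝ] E, A = ContinuousLinearMap.id ℝ E → B = ContinuousLinearMap.id ℝ E →
        A.comp (ContinuousLinearMap.fst ℝ E E) + B.comp (ContinuousLinearMap.snd ℝ E E) =
        ContinuousLinearMap.fst ℝ E E + ContinuousLinearMap.snd ℝ E E := by
      rintro A B rfl rfl; rfl
    exact aux _ _ k1 k2 ▸ h
  have hp := hγ.prodMk hδ
  have hm2 : HasMFDerivAt (𝓘(ℝ, E).prod 𝓘(ℝ, E)) 𝓘(ℝ, E) (fun p : G × G ↦ p.1 * p.2)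
      (γ 0, δ 0) (ContinuousLinearMap.fst ℝ E E + ContinuousLinearMap.snd ℝ E E) := by
    rw [hγ0, hδ0]; exact hm'
  exact hm2.comp (0 : ℝ) hp

/-- The Lie algebra of a subgroup `H`: the initial velocities of smooth curves in `H`. -/
def subgroupLieAlgebra [LieGroup 𝓘(ℝ, E) ∞ G] (H : Subgroup G) :
    Submodule ℝ (GroupLieAlgebra 𝓘(ℝ, E) G) where
  carrier := {v | IsSubgroupVelocity H v}
  zero_mem' := ⟨fun _ ↦ 1, contMDiff_const, rfl, fun _ ↦ H.one_mem, by
    rw [mfderiv_const]; rfl⟩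
  add_mem' := by
    rintro v w ⟨γ, hγ, hγ0, hγH, rfl⟩ ⟨δ, hδ, hδ0, hδH, rfl⟩
    refine ⟨fun t ↦ γ t * δ t, hγ.mul hδ, by simp [hγ0, hδ0],
      fun t ↦ H.mul_mem (hγH t) (hδH t), ?_⟩
    rw [(mfderiv_mul_curves (hγ.mdifferentiable (by simp) 0).hasMFDerivAt
      (hδ.mdifferentiable (by simp) 0).hasMFDerivAt hγ0 hδ0).mfderiv]
    rfl
  smul_mem' := by
    rintro a v ⟨γ, hγ, hγ0, hγH, rfl⟩
    have hs : ContMDiff 𝓘(ℝ, ℝ) 𝓘(ℝ, ℝ) ∞ (fun t : ℝ ↦ a * t) :=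
      (contDiff_const.mul contDiff_id).contMDiff
    refine ⟨fun t ↦ γ (a * t), hγ.comp hs, by simp [hγ0], fun t ↦ hγH _, ?_⟩
    rw [(mfderiv_comp_mul_curve a (hγ.mdifferentiable (by simp) 0).hasMFDerivAt).mfderiv]
    rfl

variable [LieGroup 𝓘(ℝ, E) ∞ G]

/-- Reductive decompositions `𝔤 = 𝔥 + 𝔪`. -/
structure IsReductiveDecomposition (H : Subgroup G)
    (𝔪 : Submodule ℝ (GroupLieAlgebra 𝓘(ℝ, E) G)) : Prop where
  isCompl : IsCompl (subgroupLieAlgebra H) 𝔪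
  ad_mem : ∀ h ∈ H, ∀ v ∈ 𝔪, Ad h v ∈ 𝔪

/-- `Ad(H)`-invariant, positively 2-homogeneous smooth maps `𝔪 ∖ {0} → 𝔪` (extended by zero
to the origin). -/
structure IsInvariantHomogeneousMap (H : Subgroup G)
    (𝔪 : Submodule ℝ (GroupLieAlgebra 𝓘(ℝ, E) G)) (η : 𝔪 → 𝔪) : Prop where
  smooth : ContDiffOn ℝ ∞ η {0}ᶜ
  zero_off : η 0 = 0
  homogeneous : ∀ r : ℝ, 0 < r → ∀ y : 𝔪, y ≠ 0 → η (r • y) = r ^ 2 • η y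
  ad_invariant : ∀ h ∈ H, ∀ y z : 𝔪, y ≠ 0 →
    (z : GroupLieAlgebra 𝓘(ℝ, E) G) = Ad h (y : GroupLieAlgebra 𝓘(ℝ, E) G) →
    (η z : GroupLieAlgebra 𝓘(ℝ, E) G) = Ad h (η y : GroupLieAlgebra 𝓘(ℝ, E) G)

variable {F : Type*} [NormedAddCommGroup F] [NormedSpace ℝ F] {H : Subgroup G}
  [ChartedSpace F (G ⧸ H)] [IsManifold 𝓘(ℝ, F) ∞ (G ⧸ H)]

variable (H) in
/-- The projection `π : G → G/H`, `g ↦ g · o`. -/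
abbrev proj (g : G) : G ⧸ H := QuotientGroup.mk g

/-- `c` is a geodesic of `W` near `t = 0` with `c(0) = o` and initial velocity corresponding to
`y ∈ 𝔪`, and `γ` is the lift of `c` to `G` near `t = 0` with `γ(0) = e` whose left translated
velocity stays in `𝔪 ∖ {0}`. -/
structure IsGeodesicLift (𝔪 : Submodule ℝ (GroupLieAlgebra 𝓘(ℝ, E) G))
    (W : TangentBundleField F (G ⧸ H)) (y : 𝔪) (c : ℝ → G ⧸ H) (γ : ℝ → G) : Prop where
  velocity_zero : velocity c 0 = tangentMap 𝓘(ℝ, E) 𝓘(ℝ, F) (proj H) ⟨1, y⟩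
  lift_zero : γ 0 = 1
  lift : ∃ ε > 0, IsGeodesicOn W c (Set.Ioo (-ε) ε) ∧
    ContMDiffOn 𝓘(ℝ, ℝ) 𝓘(ℝ, E) ∞ γ (Set.Ioo (-ε) ε) ∧
    ∀ t ∈ Set.Ioo (-ε) ε, proj H (γ t) = c t ∧
      leftVelocity (E := E) γ t ∈ 𝔪 ∧ leftVelocity (E := E) γ t ≠ 0

open Classical in
/-- The spray vector field `η : 𝔪 ∖ {0} → 𝔪` of `W`: `η(y) = - d/dt|_{t=0} y(t)`, where
`y(t) = (L_{γ(t)⁻¹})_* γ'(t)` and `γ` is the lift of a geodesic with initial velocity `y`.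
(The value at `0`, or if there is no such lift, is set to `0`.) -/
def sprayVectorField (𝔪 : Submodule ℝ (GroupLieAlgebra 𝓘(ℝ, E) G))
    (W : TangentBundleField F (G ⧸ H)) (y : 𝔪) : 𝔪 :=
  if h : ∃ w : 𝔪, y ≠ 0 ∧ ∃ c γ, IsGeodesicLift 𝔪 W y c γ ∧
      HasDerivAt (leftVelocity γ) (w : GroupLieAlgebra 𝓘(ℝ, E) G) 0
  then -h.choose else 0

/-- The vector field `Y` on `G/H`, read as the function `g ↦ (g⁻¹)_* Y(g · o)` on `G` with values
in `T_o(G/H)` (which is by definition the model space `F`). -/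
def framedField (Y : ∀ x : G ⧸ H, TangentSpace 𝓘(ℝ, F) x) (g : G) : F :=
  mfderiv 𝓘(ℝ, F) 𝓘(ℝ, F) (fun x : G ⧸ H ↦ g⁻¹ • x) (proj H g) (Y (proj H g))

/-- `D` is the Nomizu connection of `𝔤 = 𝔥 + 𝔪` (the canonical connection of the reductive
homogeneous space): the affine connection on `G/H` induced by the principal connection on
`G → G/H` with horizontal spaces `(L_g)_* 𝔪`.  Explicitly, the covariant derivative at `g · o` of
`Y` in the direction `π_* (L_g)_* ξ`, `ξ ∈ 𝔪`, is `g_*` of the derivative of the `T_o(G/H)`-valued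
function `framedField Y` in the direction of the horizontal vector `(L_g)_* ξ`. -/
def IsNomizuConnection (𝔪 : Submodule ℝ (GroupLieAlgebra 𝓘(ℝ, E) G))
    (D : CovariantDerivative 𝓘(ℝ, F) F (TangentSpace 𝓘(ℝ, F) : G ⧸ H → Type _)) : Prop :=
  ∀ (Y : ∀ x : G ⧸ H, TangentSpace 𝓘(ℝ, F) x) (g : G),
    MDifferentiableAt 𝓘(ℝ, F) 𝓘(ℝ, F).tangent
      (fun z ↦ (⟨z, Y z⟩ : TangentBundle 𝓘(ℝ, F) (G ⧸ H))) (proj H g) →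
    ∀ ξ ∈ 𝔪,
      D Y (proj H g) (mfderiv 𝓘(ℝ, E) 𝓘(ℝ, F) (proj H) g (mulInvariantVectorField ξ g)) =
      mfderiv 𝓘(ℝ, F) 𝓘(ℝ, F) (fun x : G ⧸ H ↦ g • x) (proj H 1)
        (mfderiv 𝓘(ℝ, E) 𝓘(ℝ, F) (framedField Y) g (mulInvariantVectorField ξ g))

/-- The restriction of `V` to `T_o(G/H) ∖ {0} = 𝔪 ∖ {0}` is `η`, under the identification of `𝔪`
with `T_o(G/H)` by the differential of the projection. -/
def RestrictsTo (𝔪 : Submodule ℝ (GroupLieAlgebra 𝓘(ℝ, E) G))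
    (V : TangentBundleField F (G ⧸ H)) (η : 𝔪 → 𝔪) : Prop :=
  ∀ y : 𝔪, y ≠ 0 →
    V ⟨proj H 1, mfderiv 𝓘(ℝ, E) 𝓘(ℝ, F) (proj H) 1 y⟩ =
      verticalLift ⟨proj H 1, mfderiv 𝓘(ℝ, E) 𝓘(ℝ, F) (proj H) 1 y⟩
        (mfderiv 𝓘(ℝ, E) 𝓘(ℝ, F) (proj H) 1 (η y))

end LieGroups

end SprayGeometry

end

open SprayGeometry

open scoped Manifold ContDiff
noncomputable section
set_option linter.unusedSectionVars false
namespace SprayGeometry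
open Filter Topology Set

/-! ### Standard coordinates on the tangent bundle -/

section Tangent

variable {E F M N : Type*} [NormedAddCommGroup E] [NormedSpace ℝ E]
  [NormedAddCommGroup F] [NormedSpace ℝ F]
  [TopologicalSpace M] [ChartedSpace F M]

/-! Everything is pulled back to `G × T_o(G/H)` by `frameMap`, `(g, v) ↦ g_* v`. This map is onto
`T(G/H)`, has smooth local sections, is equivariant for left translation of `g`, and its fibres are
the orbits of `H` acting by `(g, v) ↦ (g h⁻¹, h_* v)`. The complement `𝔪` supplies a linear map `b :
T_o(G/H) → 𝔤` with image `𝔪` and `π_* b = id`; it is `H`-equivariant because `Ad(H) 𝔪 ⊂ 𝔪`.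

An invariant spray is then the same thing as a vector field `((L_g)_* b(v), -ζ(v))` upstairs. Its
first entry is the lift in `(L_g)_* 𝔪` of the component `y ∂_x` common to all sprays. Once this
entry is fixed, what remains is vertical, so the second entry is determined, and left invariance
removes its dependence on `g`. Such a field descends to `T(G/H)` when `ζ` commutes with the isotropy
representation, and the quadratic scaling of the spray coefficients corresponds to that of `ζ`. This
is the content of `exists_isRelatedField`, `isRelatedField_inducedField` and
`IsRelatedField.isSpray`.

Integral curves of the field upstairs satisfy `g⁻¹ g' = b(v)` and `v' = -ζ(v)`. Hence `g` is a lift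
of a geodesic with left velocity `b(v(t))` in `𝔪`, and minus the derivative of that velocity is
`b(ζ(v))`: under `𝔪 = T_o(G/H)` the map `ζ` is the spray vector field. Existence of lifts is
`exists_isGeodesicLift`; that every lift has this derivative is `hasDerivAt_leftVelocity`.

For the Nomizu connection, a vector field `Y` is lifted to the graph `g ↦ (g, framedField Y g)`.
Differentiating the graph in a horizontal direction produces, in the fibre, exactly the Nomizu
derivative of `Y`; removing it leaves `((L_g)_* b(v), 0)`, the field with `ζ = 0`. So `W₀ - W` is
the image of `(0, ζ(v))`, a vertical field restricting to the spray vector field at `o`, and an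
invariant field is determined by its values over `o`. -/

theorem tangentBundle_ext {p q : TangentBundle 𝓘(ℝ, F) M} (h1 : p.1 = q.1)
    (h2 : (p.2 : F) = (q.2 : F)) : p = q := by
  obtain ⟨a, v⟩ := p
  obtain ⟨b, w⟩ := q
  obtain rfl : a = b := h1
  obtain rfl : v = w := h2
  rfl

theorem mdifferentiable_of_mem_maximalAtlas {e : OpenPartialHomeomorph M F}
    (he : e ∈ IsManifold.maximalAtlas 𝓘(ℝ, F) ∞ M) :
    e.MDifferentiable 𝓘(ℝ, F) 𝓘(ℝ, F) :=
  ⟨(contMDiffOn_of_mem_maximalAtlas he).mdifferentiableOn (by simp),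
    (contMDiffOn_symm_of_mem_maximalAtlas he).mdifferentiableOn (by simp)⟩

variable [IsManifold 𝓘(ℝ, F) ∞ M]

theorem isOpen_preimage_proj {s : Set M} (hs : IsOpen s) :
    IsOpen {p : TangentBundle 𝓘(ℝ, F) M | p.1 ∈ s} :=
  hs.preimage (FiberBundle.continuous_proj F (TangentSpace 𝓘(ℝ, F) : M → Type _))

theorem contMDiffOn_stdCoord {e : OpenPartialHomeomorph M F}
    (he : e ∈ IsManifold.maximalAtlas 𝓘(ℝ, F) ∞ M) :
    ContMDiffOn 𝓘(ℝ, F).tangent 𝓘(ℝ, F × F) ∞ (stdCoord e)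
      {p : TangentBundle 𝓘(ℝ, F) M | p.1 ∈ e.source} := by
  have h0 := contMDiffOn_of_mem_maximalAtlas he
  have h1 := h0.contMDiffOn_tangentMapWithin (m := ∞) (by simp) e.open_source.uniqueMDiffOn
  have h2 := (contMDiff_snd_tangentBundle_modelSpace F 𝓘(ℝ, F) (n := ∞)).comp_contMDiffOn h1
  have h3 : ContMDiffOn 𝓘(ℝ, F).tangent 𝓘(ℝ, F) ∞ (fun p ↦ e p.1)
      {p : TangentBundle 𝓘(ℝ, F) M | p.1 ∈ e.source} :=
    h0.comp (Bundle.contMDiffOn_proj _) fun p hp ↦ hp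
  refine (h3.prodMk_space h2).congr fun p hp ↦ ?_
  refine Prod.ext rfl ?_
  change mfderiv 𝓘(ℝ, F) 𝓘(ℝ, F) e p.1 p.2 =
    mfderivWithin 𝓘(ℝ, F) 𝓘(ℝ, F) e e.source p.1 p.2
  rw [mfderivWithin_of_isOpen e.open_source hp]

theorem contMDiff_tangentBundle_mk :
    ContMDiff 𝓘(ℝ, F × F) 𝓘(ℝ, F).tangent ∞
      (fun z : F × F ↦ (⟨z.1, z.2⟩ : TangentBundle 𝓘(ℝ, F) F)) := by
  intro z
  refine Bundle.contMDiffAt_totalSpace.2 ⟨contDiff_fst.contMDiff.contMDiffAt, ?_⟩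
  simpa using! contDiff_snd.contMDiff.contMDiffAt

/-- The inverse of the standard coordinates. -/
def stdCoordSymm (e : OpenPartialHomeomorph M F) (z : F × F) : TangentBundle 𝓘(ℝ, F) M :=
  tangentMap 𝓘(ℝ, F) 𝓘(ℝ, F) e.symm ⟨z.1, z.2⟩

theorem contMDiffOn_stdCoordSymm {e : OpenPartialHomeomorph M F}
    (he : e ∈ IsManifold.maximalAtlas 𝓘(ℝ, F) ∞ M) :
    ContMDiffOn 𝓘(ℝ, F × F) 𝓘(ℝ, F).tangent ∞ (stdCoordSymm (M := M) e)
      (e.target ×ˢ univ) := by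
  have h1 := (contMDiffOn_symm_of_mem_maximalAtlas he).contMDiffOn_tangentMapWithin (m := ∞)
    (by simp) e.open_target.uniqueMDiffOn
  refine (h1.comp contMDiff_tangentBundle_mk.contMDiffOn (fun z hz ↦ hz.1)).congr fun p hp ↦ ?_
  refine tangentBundle_ext rfl ?_
  change mfderiv 𝓘(ℝ, F) 𝓘(ℝ, F) e.symm p.1 p.2 =
    mfderivWithin 𝓘(ℝ, F) 𝓘(ℝ, F) e.symm e.target p.1 p.2
  rw [mfderivWithin_of_isOpen e.open_target hp.1]

theorem stdCoordSymm_stdCoord {e : OpenPartialHomeomorph M F}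
    (he : e ∈ IsManifold.maximalAtlas 𝓘(ℝ, F) ∞ M) {p : TangentBundle 𝓘(ℝ, F) M}
    (hp : p.1 ∈ e.source) : stdCoordSymm e (stdCoord e p) = p := by
  have h := (mdifferentiable_of_mem_maximalAtlas he).symm_comp_deriv hp
  refine tangentBundle_ext (e.left_inv hp) ?_
  exact DFunLike.congr_fun h p.2

theorem mdifferentiableAt_stdCoord {e : OpenPartialHomeomorph M F}
    (he : e ∈ IsManifold.maximalAtlas 𝓘(ℝ, F) ∞ M) {p : TangentBundle 𝓘(ℝ, F) M}
    (hp : p.1 ∈ e.source) :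
    MDifferentiableAt 𝓘(ℝ, F).tangent 𝓘(ℝ, F × F) (stdCoord e) p :=
  (contMDiffOn_stdCoord he).mdifferentiableOn (by simp) p hp |>.mdifferentiableAt
    ((isOpen_preimage_proj e.open_source).mem_nhds hp)

/-- Components determine the tangent vector. -/
theorem stdComponents_injective {e : OpenPartialHomeomorph M F}
    (he : e ∈ IsManifold.maximalAtlas 𝓘(ℝ, F) ∞ M) {p : TangentBundle 𝓘(ℝ, F) M}
    (hp : p.1 ∈ e.source) : Function.Injective (stdComponents e p) := by
  have h1 := (mdifferentiableAt_stdCoord he hp).hasMFDerivAt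
  have h2 : MDifferentiableAt 𝓘(ℝ, F × F) 𝓘(ℝ, F).tangent (stdCoordSymm (M := M) e) (stdCoord e p) :=
    ((contMDiffOn_stdCoordSymm he).contMDiffAt ((e.open_target.prod isOpen_univ).mem_nhds
      ⟨e.map_source hp, mem_univ _⟩)).mdifferentiableAt (by simp)
  have h3 := h2.hasMFDerivAt.comp p h1
  have h4 : HasMFDerivAt 𝓘(ℝ, F).tangent 𝓘(ℝ, F).tangent
      (stdCoordSymm e ∘ stdCoord e) p (ContinuousLinearMap.id ℝ (F × F)) := by
    refine (hasMFDerivAt_id p).congr_of_eventuallyEq ?_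
    filter_upwards [(isOpen_preimage_proj e.open_source).mem_nhds hp] with q hq
    exact stdCoordSymm_stdCoord he hq
  have h5 := hasMFDerivAt_unique h3 h4
  refine Function.LeftInverse.injective
    (g := mfderiv 𝓘(ℝ, F × F) 𝓘(ℝ, F).tangent (stdCoordSymm (M := M) e) (stdCoord e p)) fun w ↦ ?_
  exact DFunLike.congr_fun h5 w

end Tangent

/-! ### Derivatives as maps between fixed model spaces -/

/-- The manifold derivative as a map between the model spaces. -/
def modelDeriv {E E' H H' M M' : Type*} [NormedAddCommGroup E] [NormedSpace ℝ E]
    [NormedAddCommGroup E'] [NormedSpace ℝ E'] [TopologicalSpace H] [TopologicalSpace H']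
    (I : ModelWithCorners ℝ E H) (J : ModelWithCorners ℝ E' H')
    [TopologicalSpace M] [ChartedSpace H M] [TopologicalSpace M'] [ChartedSpace H' M']
    (f : M → M') (x : M) : E →L[ℝ] E' := mfderiv I J f x

section ModelDeriv

variable {E E' E'' H H' H'' M M' M'' : Type*}
  [NormedAddCommGroup E] [NormedSpace ℝ E] [NormedAddCommGroup E'] [NormedSpace ℝ E']
  [NormedAddCommGroup E''] [NormedSpace ℝ E'']
  [TopologicalSpace H] [TopologicalSpace H'] [TopologicalSpace H'']
  {I : ModelWithCorners ℝ E H} {J : ModelWithCorners ℝ E' H'} {K : ModelWithCorners ℝ E'' H''}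
  [TopologicalSpace M] [ChartedSpace H M] [TopologicalSpace M'] [ChartedSpace H' M']
  [TopologicalSpace M''] [ChartedSpace H'' M'']

variable (I J) in
/-- `HasMFDerivAt` for derivatives regarded as maps between the model spaces. -/
def HasModelDerivAt (f : M → M') (x : M) (L : E →L[ℝ] E') : Prop := HasMFDerivAt I J f x L

theorem _root_.MDifferentiableAt.hasModelDerivAt {f : M → M'} {x : M}
    (h : MDifferentiableAt I J f x) : HasModelDerivAt I J f x (modelDeriv I J f x) :=
  h.hasMFDerivAt

theorem _root_.ContMDiffAt.hasModelDerivAt {f : M → M'} {x : M}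
    (h : ContMDiffAt I J ∞ f x) : HasModelDerivAt I J f x (modelDeriv I J f x) :=
  (h.mdifferentiableAt (by simp)).hasMFDerivAt

theorem _root_.HasFDerivAt.hasModelDerivAt {f : E → E'} {x : E} {L : E →L[ℝ] E'}
    (h : HasFDerivAt f L x) : HasModelDerivAt 𝓘(ℝ, E) 𝓘(ℝ, E') f x L :=
  h.hasMFDerivAt

namespace HasModelDerivAt

variable {f : M → M'} {g : M' → M''} {x : M} {L L₁ : E →L[ℝ] E'} {L' : E' →L[ℝ] E''}

theorem mdifferentiableAt (h : HasModelDerivAt I J f x L) : MDifferentiableAt I J f x :=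
  HasMFDerivAt.mdifferentiableAt h

theorem unique (h : HasModelDerivAt I J f x L) (h₁ : HasModelDerivAt I J f x L₁) : L = L₁ :=
  hasMFDerivAt_unique h h₁

theorem modelDeriv (h : HasModelDerivAt I J f x L) : modelDeriv I J f x = L :=
  h.mdifferentiableAt.hasModelDerivAt.unique h

theorem comp (hg : HasModelDerivAt J K g (f x) L') (hf : HasModelDerivAt I J f x L) :
    HasModelDerivAt I K (fun z ↦ g (f z)) x (L'.comp L) :=
  HasMFDerivAt.comp x hg hf

theorem comp_of_eq {y : M'} (hg : HasModelDerivAt J K g y L') (hf : HasModelDerivAt I J f x L)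
    (hy : f x = y) : HasModelDerivAt I K (fun z ↦ g (f z)) x (L'.comp L) := by
  subst hy; exact hg.comp hf

theorem congr {f₁ : M → M'} (h : HasModelDerivAt I J f x L) (h₁ : f₁ =ᶠ[𝓝 x] f) :
    HasModelDerivAt I J f₁ x L :=
  HasMFDerivAt.congr_of_eventuallyEq h h₁

theorem prodMk {f₁ : M → M''} {L₁ : E →L[ℝ] E''} (h : HasModelDerivAt I J f x L)
    (h₁ : HasModelDerivAt I K f₁ x L₁) :
    HasModelDerivAt I (J.prod K) (fun z ↦ (f z, f₁ z)) x (L.prod L₁) :=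
  HasMFDerivAt.prodMk h h₁

end HasModelDerivAt

theorem hasModelDerivAt_id (x : M) : HasModelDerivAt I I (fun z : M ↦ z) x
    (ContinuousLinearMap.id ℝ E) := hasMFDerivAt_id x

theorem hasModelDerivAt_const (y : M') (x : M) : HasModelDerivAt I J (fun _ : M ↦ y) x 0 :=
  hasMFDerivAt_const y x

end ModelDeriv

/-! ### Fibres of the tangent bundle and vertical lifts -/

section Vertical

variable {F M : Type*} [NormedAddCommGroup F] [NormedSpace ℝ F]
  [TopologicalSpace M] [ChartedSpace F M] [IsManifold 𝓘(ℝ, F) ∞ M]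

/-- The fibre component of a tangent vector. -/
def fiberVec (p : TangentBundle 𝓘(ℝ, F) M) : F := p.2

/-- The inclusion of a fibre of the tangent bundle. -/
def fiberMk (x : M) (v : F) : TangentBundle 𝓘(ℝ, F) M := ⟨x, v⟩

theorem contMDiff_fiberMk (x : M) :
    ContMDiff 𝓘(ℝ, F) 𝓘(ℝ, F).tangent ∞ (fiberMk (F := F) x) := by
  intro v
  refine Bundle.contMDiffAt_totalSpace.2 ⟨contMDiffAt_const, ?_⟩
  refine contMDiffAt_id.congr_of_eventuallyEq (Eventually.of_forall fun w ↦ ?_)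
  change (tangentBundleCore 𝓘(ℝ, F) M).coordChange _ _ _ _ = w
  exact (tangentBundleCore 𝓘(ℝ, F) M).coordChange_self _ _ (mem_chart_source F x) _

/-- The trivialization centred at `x` is the identity on the fibre over `x`, so it reads off `f`
itself. -/
theorem contMDiffOn_of_fiberMk {E' H' N : Type*} [NormedAddCommGroup E'] [NormedSpace ℝ E']
    [TopologicalSpace H'] {J : ModelWithCorners ℝ E' H'} [TopologicalSpace N] [ChartedSpace H' N]
    (x : M) {f : N → F} {s : Set N}
    (hf : ContMDiffOn J 𝓘(ℝ, F).tangent ∞ (fun z ↦ fiberMk x (f z)) s) :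
    ContMDiffOn J 𝓘(ℝ, F) ∞ f s := by
  intro z hz
  have h1 : ∀ v : F, (trivializationAt F (TangentSpace 𝓘(ℝ, F)) x (fiberMk x v)).2 = v :=
    fun v ↦ (tangentBundleCore 𝓘(ℝ, F) M).coordChange_self _ _ (mem_chart_source F x) v
  exact (Bundle.contMDiffWithinAt_totalSpace.1 (hf z hz)).2.congr (fun y _ ↦ (h1 (f y)).symm)
    (h1 (f z)).symm

theorem hasMFDerivAt_fiberMk (x : M) (v : F) :
    HasMFDerivAt 𝓘(ℝ, F) 𝓘(ℝ, F).tangent (fiberMk x) v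
      (mfderiv 𝓘(ℝ, F) 𝓘(ℝ, F).tangent (fiberMk (F := F) x) v) :=
  ((contMDiff_fiberMk x).mdifferentiable (by simp) v).hasMFDerivAt

/-- The line `t ↦ p + t w` is an affine curve inside one fibre; the chain rule expresses its
velocity by the differential of the inclusion of the fibre, which makes linearity in `w` available.
-/
theorem verticalLift_eq (p : TangentBundle 𝓘(ℝ, F) M) (w : F) :
    verticalLift p w = mfderiv 𝓘(ℝ, F) 𝓘(ℝ, F).tangent (fiberMk (F := F) p.1) (fiberVec p) w := by
  have h1 : HasMFDerivAt 𝓘(ℝ, ℝ) 𝓘(ℝ, F) (fun t : ℝ ↦ (fiberVec p) + t • w) 0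
      ((1 : ℝ →L[ℝ] ℝ).smulRight w) := by
    refine HasFDerivAt.hasMFDerivAt ?_
    exact (((hasDerivAt_id (0 : ℝ)).smul_const w).const_add (fiberVec p)).hasFDerivAt.congr_fderiv
      (by ext; simp; exact (one_smul ℝ w).symm)
  have h2 : HasMFDerivAt 𝓘(ℝ, F) 𝓘(ℝ, F).tangent (fiberMk (F := F) p.1) ((fiberVec p) + (0 : ℝ) • w)
      (mfderiv 𝓘(ℝ, F) 𝓘(ℝ, F).tangent (fiberMk (F := F) p.1) (fiberVec p)) := by
    rw [zero_smul, add_zero]; exact hasMFDerivAt_fiberMk _ _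
  have h3 := (h2.comp (0 : ℝ) h1).mfderiv
  have h4 := DFunLike.congr_fun h3 (1 : ℝ)
  refine h4.trans ?_
  change mfderiv 𝓘(ℝ, F) 𝓘(ℝ, F).tangent (fiberMk (F := F) p.1) (fiberVec p) ((1 : ℝ) • w) = _
  rw [one_smul]

/-- In standard coordinates the inclusion of the fibre is `v ↦ (e x, de_x v)`: constant in the first
slot, linear in the second. -/
theorem stdComponents_verticalLift {e : OpenPartialHomeomorph M F}
    (he : e ∈ IsManifold.maximalAtlas 𝓘(ℝ, F) ∞ M) {p : TangentBundle 𝓘(ℝ, F) M}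
    (hp : p.1 ∈ e.source) (w : F) :
    stdComponents e p (verticalLift p w) = ((0 : F), mfderiv 𝓘(ℝ, F) 𝓘(ℝ, F) e p.1 w) := by
  rw [verticalLift_eq]
  have h1 := (mdifferentiableAt_stdCoord he hp).hasMFDerivAt.comp (fiberVec p)
    (hasMFDerivAt_fiberMk p.1 (fiberVec p))
  have h2 : HasMFDerivAt 𝓘(ℝ, F) 𝓘(ℝ, F × F) (stdCoord e ∘ fiberMk p.1) (fiberVec p)
      ((0 : F →L[ℝ] F).prod (modelDeriv 𝓘(ℝ, F) 𝓘(ℝ, F) e p.1)) := by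
    refine HasFDerivAt.hasMFDerivAt ?_
    exact (hasFDerivAt_const (e p.1) _).prodMk
      (ContinuousLinearMap.hasFDerivAt (modelDeriv 𝓘(ℝ, F) 𝓘(ℝ, F) e p.1))
  exact DFunLike.congr_fun (hasMFDerivAt_unique h1 h2) w

theorem stdComponents_fst {e : OpenPartialHomeomorph M F}
    (he : e ∈ IsManifold.maximalAtlas 𝓘(ℝ, F) ∞ M) {p : TangentBundle 𝓘(ℝ, F) M}
    (hp : p.1 ∈ e.source) (w : TangentSpace 𝓘(ℝ, F).tangent p) :
    (stdComponents e p w).1 = mfderiv 𝓘(ℝ, F) 𝓘(ℝ, F) e p.1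
      (mfderiv 𝓘(ℝ, F).tangent 𝓘(ℝ, F) (fun q : TangentBundle 𝓘(ℝ, F) M ↦ q.1) p w) := by
  have h1 : HasMFDerivAt 𝓘(ℝ, F × F) 𝓘(ℝ, F) (Prod.fst : F × F → F) (stdCoord e p)
      (ContinuousLinearMap.fst ℝ F F) := hasFDerivAt_fst.hasMFDerivAt
  have h2 := h1.comp p (mdifferentiableAt_stdCoord he hp).hasMFDerivAt
  have h3 : HasMFDerivAt 𝓘(ℝ, F).tangent 𝓘(ℝ, F) (fun q : TangentBundle 𝓘(ℝ, F) M ↦ q.1) p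
      (mfderiv 𝓘(ℝ, F).tangent 𝓘(ℝ, F) (fun q : TangentBundle 𝓘(ℝ, F) M ↦ q.1) p) :=
    ((Bundle.contMDiff_proj (TangentSpace 𝓘(ℝ, F) : M → Type _) (n := ∞)).mdifferentiable
      (by simp) p).hasMFDerivAt
  have h4 := (((mdifferentiable_of_mem_maximalAtlas he).mdifferentiableAt hp).hasMFDerivAt).comp p h3
  exact DFunLike.congr_fun (hasMFDerivAt_unique h2 h4) w

theorem verticalLift_injective (p : TangentBundle 𝓘(ℝ, F) M) :
    Function.Injective (fun w : F ↦ verticalLift p w) := by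
  intro v w hvw
  have he := IsManifold.chart_mem_maximalAtlas (I := 𝓘(ℝ, F)) (n := ∞) p.1
  have hp := mem_chart_source F p.1
  have h := congrArg (fun z ↦ (stdComponents (chartAt F p.1) p z).2) hvw
  simp only [stdComponents_verticalLift he hp] at h
  exact (mdifferentiable_of_mem_maximalAtlas he).mfderiv_injective hp h

/-- The differential of the chart is onto, so every second component is realised by a vertical lift,
and components determine the vector. -/
theorem exists_eq_verticalLift {e : OpenPartialHomeomorph M F}
    (he : e ∈ IsManifold.maximalAtlas 𝓘(ℝ, F) ∞ M) {p : TangentBundle 𝓘(ℝ, F) M}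
    (hp : p.1 ∈ e.source) (w : TangentSpace 𝓘(ℝ, F).tangent p)
    (hw : (stdComponents e p w).1 = 0) : ∃ v : F, w = verticalLift p v := by
  obtain ⟨v, hv⟩ := (mdifferentiable_of_mem_maximalAtlas he).mfderiv_surjective hp
    (stdComponents e p w).2
  refine ⟨v, stdComponents_injective he hp ?_⟩
  exact (Prod.ext hw hv.symm).trans (stdComponents_verticalLift he hp v).symm

end Vertical

/-! ### Tangent maps depending on a parameter -/

section Partial

variable {E F F' N M M' : Type*} [NormedAddCommGroup E] [NormedSpace ℝ E]
  [NormedAddCommGroup F] [NormedSpace ℝ F] [NormedAddCommGroup F'] [NormedSpace ℝ F']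
  [TopologicalSpace N] [ChartedSpace E N] [IsManifold 𝓘(ℝ, E) ∞ N]
  [TopologicalSpace M] [ChartedSpace F M] [IsManifold 𝓘(ℝ, F) ∞ M]
  [TopologicalSpace M'] [ChartedSpace F' M'] [IsManifold 𝓘(ℝ, F') ∞ M']

/-- Smooth dependence of tangent maps on a parameter. -/
theorem contMDiff_tangentMap_param {f : N × M → M'}
    (hf : ContMDiff (𝓘(ℝ, E).prod 𝓘(ℝ, F)) 𝓘(ℝ, F') ∞ f) :
    ContMDiff (𝓘(ℝ, E).prod 𝓘(ℝ, F).tangent) 𝓘(ℝ, F').tangent ∞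
      (fun q : N × TangentBundle 𝓘(ℝ, F) M ↦
        tangentMap 𝓘(ℝ, F) 𝓘(ℝ, F') (fun x ↦ f (q.1, x)) q.2) := by
  -- A tangent vector of `M` is completed by zero in the parameter direction; the tangent map of `f`
  -- on the product then restricts to the partial one.
  have h1 : ContMDiff (𝓘(ℝ, E).prod 𝓘(ℝ, F).tangent) 𝓘(ℝ, E).tangent ∞
      (fun q : N × TangentBundle 𝓘(ℝ, F) M ↦ (⟨q.1, 0⟩ : TangentBundle 𝓘(ℝ, E) N)) :=
    (Bundle.contMDiff_zeroSection ℝ (TangentSpace 𝓘(ℝ, E) : N → Type _)).comp contMDiff_fst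
  have h2 := (contMDiff_equivTangentBundleProd_symm (I := 𝓘(ℝ, E)) (M := N) (I' := 𝓘(ℝ, F))
    (M' := M) (n := ∞)).comp (h1.prodMk contMDiff_snd)
  have h3 := (hf.contMDiff_tangentMap (m := ∞) (by simp)).comp h2
  convert h3 using 1
  ext1 q
  refine tangentBundle_ext rfl ?_
  have h4 := mfderiv_prod_eq_add_apply (hf.mdifferentiable (by simp) (q.1, q.2.1))
    (v := ((0 : E), fiberVec q.2))
  refine (h4.trans ?_).symm
  have h5 := map_zero (modelDeriv 𝓘(ℝ, E) 𝓘(ℝ, F') (fun z ↦ f (z, q.2.1)) q.1)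
  exact (congrArg (· + modelDeriv 𝓘(ℝ, F) 𝓘(ℝ, F') (fun z ↦ f (q.1, z)) q.2.1 (fiberVec q.2))
    h5).trans (zero_add _)

end Partial

/-! ### Local sections and fibres of submersions -/

section Submersion

variable {E F M N : Type*} [NormedAddCommGroup E] [NormedSpace ℝ E]
  [NormedAddCommGroup F] [NormedSpace ℝ F]
  [TopologicalSpace M] [ChartedSpace E M]
  [TopologicalSpace N] [ChartedSpace F N]
  {f : M → N} {x : M}

theorem submersion_normal_form (hf : Manifold.IsSubmersionAt 𝓘(ℝ, E) 𝓘(ℝ, F) ∞ f x) :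
    ∃ e ∈ IsManifold.maximalAtlas 𝓘(ℝ, E) ∞ M, ∃ c ∈ IsManifold.maximalAtlas 𝓘(ℝ, F) ∞ N,
      x ∈ e.source ∧ ∃ A : E ≃L[ℝ] F × hf.complement,
        ∀ z ∈ e.source, f z ∈ c.source ∧ c (f z) = (A (e z)).1 := by
  refine ⟨hf.domChart, hf.domChart_mem_maximalAtlas, hf.codChart, hf.codChart_mem_maximalAtlas,
    hf.mem_domChart_source, hf.equiv, fun z hz ↦ ⟨hf.source_subset_preimage_source hz, ?_⟩⟩
  have h := hf.writtenInCharts (((hf.domChart).extend 𝓘(ℝ, E)).map_source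
    (by simpa [OpenPartialHomeomorph.extend_source] using hz))
  simpa [hf.domChart.left_inv hz] using h

/-- Submersions have local sections. -/
theorem exists_local_section (hf : Manifold.IsSubmersionAt 𝓘(ℝ, E) 𝓘(ℝ, F) ∞ f x) :
    ∃ U : Set N, IsOpen U ∧ f x ∈ U ∧ ∃ s : N → M, ContMDiffOn 𝓘(ℝ, F) 𝓘(ℝ, E) ∞ s U ∧
      s (f x) = x ∧ ∀ y ∈ U, f (s y) = y := by
  obtain ⟨e, he, c, hc, hx, A, h⟩ := submersion_normal_form hf
  -- The section freezes the complementary coordinates at their value at `x`.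
  set k := (A (e x)).2
  set j : F → E := fun z ↦ A.symm (z, k) with hj
  have hjs : ContDiff ℝ ∞ j := A.symm.contDiff.comp (contDiff_id.prodMk contDiff_const)
  have hjx : j (c (f x)) = e x := by
    rw [hj, (h x hx).2]; exact A.symm_apply_apply _
  have hO : IsOpen (c.source ∩ c ⁻¹' (j ⁻¹' e.target)) :=
    c.continuousOn.isOpen_inter_preimage c.open_source (e.open_target.preimage hjs.continuous)
  refine ⟨_, hO, ⟨(h x hx).1, ?_⟩, fun y ↦ e.symm (j (c y)), ?_, ?_, ?_⟩
  · change j (c (f x)) ∈ e.target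
    rw [hjx]; exact e.map_source hx
  · refine (contMDiffOn_symm_of_mem_maximalAtlas he).comp (t := e.target) (hjs.contMDiff.comp_contMDiffOn
      ((contMDiffOn_of_mem_maximalAtlas hc).mono inter_subset_left)) fun y hy ↦ hy.2
  · simp only [hjx, e.left_inv hx]
  · rintro y ⟨hy1, hy2⟩
    have h1 := e.map_target hy2
    refine c.injOn (h _ h1).1 hy1 ?_
    rw [(h _ h1).2, e.right_inv hy2, hj]
    simp

/-- The differential of a local section through `x` is a right inverse. -/
theorem mfderiv_surjective_of_submersion (hf : Manifold.IsSubmersionAt 𝓘(ℝ, E) 𝓘(ℝ, F) ∞ f x) :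
    Function.Surjective (modelDeriv 𝓘(ℝ, E) 𝓘(ℝ, F) f x) := by
  obtain ⟨U, hU, hxU, s, hs, hsx, hfs⟩ := exists_local_section hf
  have h1 := (hs.contMDiffAt (hU.mem_nhds hxU)).hasModelDerivAt
  have h2 := hf.contMDiffAt.hasModelDerivAt.comp_of_eq h1 hsx
  have h3 := (hasModelDerivAt_id (I := 𝓘(ℝ, F)) (f x)).congr (f₁ := fun y ↦ f (s y)) (by
    filter_upwards [hU.mem_nhds hxU] with y hy using hfs y hy)
  exact fun v ↦ ⟨_, DFunLike.congr_fun (h2.unique h3) v⟩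

/-- Vectors in the kernel of the differential of a submersion are tangent to curves in its fibre. -/
theorem exists_curve_in_fiber (hf : Manifold.IsSubmersionAt 𝓘(ℝ, E) 𝓘(ℝ, F) ∞ f x) {v : E}
    (hv : modelDeriv 𝓘(ℝ, E) 𝓘(ℝ, F) f x v = 0) :
    ∃ γ : ℝ → M, ContMDiff 𝓘(ℝ, ℝ) 𝓘(ℝ, E) ∞ γ ∧ γ 0 = x ∧ (∀ t, f (γ t) = f x) ∧
      mfderiv 𝓘(ℝ, ℝ) 𝓘(ℝ, E) γ 0 (1 : ℝ) = v := by
  obtain ⟨e, he, c, hc, hx, A, h⟩ := submersion_normal_form hf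
  have hem := mdifferentiable_of_mem_maximalAtlas he
  have hcm := mdifferentiable_of_mem_maximalAtlas hc
  set w : E := modelDeriv 𝓘(ℝ, E) 𝓘(ℝ, E) e x v with hw
  -- In the charts `f` is the first component of `A`, so the line in direction `w` stays in the
  -- fibre.
  have hAw : (A w).1 = 0 := by
    have h1 := (hcm.mdifferentiableAt (h x hx).1).hasModelDerivAt.comp hf.contMDiffAt.hasModelDerivAt
    have h2 := ((ContinuousLinearMap.fst ℝ F hf.complement).comp
        (A : E →L[ℝ] F × hf.complement)).hasFDerivAt (x := e x) |>.hasModelDerivAt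
    have h3 := (h2.comp (hem.mdifferentiableAt hx).hasModelDerivAt).congr
        (f₁ := fun z ↦ c (f z)) (by
      filter_upwards [e.open_source.mem_nhds hx] with z hz using (h z hz).2)
    have h4 := DFunLike.congr_fun (h1.unique h3) v
    rw [ContinuousLinearMap.comp_apply, hv, map_zero] at h4
    exact h4.symm
  obtain ⟨ε, hε, hball⟩ : ∃ ε > 0, ∀ t : ℝ, |t| < ε → e x + t • w ∈ e.target := by
    have : ContinuousAt (fun t : ℝ ↦ e x + t • w) 0 := by fun_prop
    have h1 := this.preimage_mem_nhds (e.open_target.mem_nhds (by simpa using e.map_source hx))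
    obtain ⟨ε, hε, hb⟩ := Metric.mem_nhds_iff.1 h1
    exact ⟨ε, hε, fun t ht ↦ hb (by simpa using ht)⟩
  -- The sine keeps the parameter in `(-ε, ε)` for every `t`, with `ψ 0 = 0` and `ψ' 0 = 1`: the
  -- curve is defined on all of `ℝ`, as membership in `subgroupLieAlgebra` demands.
  set ψ : ℝ → ℝ := fun t ↦ ε / 2 * Real.sin (2 / ε * t) with hψ
  have hψs : ContDiff ℝ ∞ ψ := contDiff_const.mul (Real.contDiff_sin.comp (contDiff_const.mul contDiff_id))
  have hψb : ∀ t, |ψ t| < ε := fun t ↦ by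
    rw [hψ, abs_mul, abs_of_pos (by positivity)]
    nlinarith [Real.abs_sin_le_one (2 / ε * t)]
  have hψ0 : ψ 0 = 0 := by simp [hψ]
  have hψd : HasDerivAt ψ 1 0 := by
    have h1 : HasDerivAt (fun t : ℝ ↦ 2 / ε * t) (2 / ε) 0 := by
      simpa using (hasDerivAt_id (0 : ℝ)).const_mul (2 / ε)
    have h2 := (h1.sin).const_mul (ε / 2)
    simp only [mul_zero, Real.cos_zero, one_mul] at h2
    have : ε / 2 * (2 / ε) = 1 := by field_simp
    rwa [this] at h2
  have hδs : ContDiff ℝ ∞ (fun t ↦ e x + ψ t • w) :=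
    contDiff_const.add (hψs.smul contDiff_const)
  refine ⟨fun t ↦ e.symm (e x + ψ t • w), ?_, ?_, ?_, ?_⟩
  · exact (contMDiffOn_symm_of_mem_maximalAtlas he).comp_contMDiff hδs.contMDiff
      fun t ↦ hball _ (hψb t)
  · simp [hψ0, e.left_inv hx]
  · intro t
    have h1 := e.map_target (hball _ (hψb t))
    refine c.injOn (h _ h1).1 (h x hx).1 ?_
    rw [(h _ h1).2, e.right_inv (hball _ (hψb t)), (h x hx).2]
    simp [hAw]
  · have h1 := (((hψd.smul_const w).const_add (e x)).hasFDerivAt).hasModelDerivAt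
    have h2 := (hem.mdifferentiableAt_symm (e.map_source hx)).hasModelDerivAt.comp_of_eq h1
      (by rw [hψ0, zero_smul, add_zero])
    have h3 := DFunLike.congr_fun h2.modelDeriv (1 : ℝ)
    refine h3.trans ?_
    rw [ContinuousLinearMap.comp_apply, ContinuousLinearMap.toSpanSingleton_apply, one_smul,
      one_smul]
    exact DFunLike.congr_fun (hem.symm_comp_deriv hx) v

end Submersion

/-! ### Regularity of integral curves -/

section IntegralCurve

variable {E M : Type*} [NormedAddCommGroup E] [NormedSpace ℝ E]
  {H : Type*} [TopologicalSpace H] {I : ModelWithCorners ℝ E H}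
  [TopologicalSpace M] [ChartedSpace H M] [IsManifold I ∞ M]

/-- Integral curves of smooth vector fields are smooth. -/
theorem contMDiffOn_of_isMIntegralCurveOn {v : ∀ x : M, TangentSpace I x} {U : Set M}
    (hv : ContMDiffOn I I.tangent ∞ (fun x ↦ (⟨x, v x⟩ : TangentBundle I M)) U)
    {γ : ℝ → M} {s : Set ℝ} (hs : IsOpen s) (hγU : ∀ t ∈ s, γ t ∈ U)
    (hγ : IsMIntegralCurveOn γ v s) : ContMDiffOn 𝓘(ℝ, ℝ) I ∞ γ s := by
  have main : ∀ n : ℕ, ContMDiffOn 𝓘(ℝ, ℝ) I n γ s := by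
    intro n
    -- Bootstrap: in a chart the derivative of `γ` is the field along `γ`, so a `C^n` curve has a
    -- `C^n` derivative.
    induction n with
    | zero => exact contMDiffOn_zero_iff.2 hγ.continuousOn
    | succ n ih =>
      intro t₀ ht₀
      refine ContMDiffAt.contMDiffWithinAt ?_
      have hγc : ContinuousAt γ t₀ := (hγ.continuousOn t₀ ht₀).continuousAt (hs.mem_nhds ht₀)
      refine contMDiffAt_iff_target.2 ⟨hγc, ?_⟩
      have hd := (hγ.isMIntegralCurveAt (hs.mem_nhds ht₀)).eventually_hasDerivAt
      obtain ⟨u, hu, huo, htu⟩ := eventually_nhds_iff.1 (hd.and ((hs.eventually_mem ht₀).and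
        (hγc.eventually ((chartAt H (γ t₀)).open_source.eventually_mem
          (mem_chart_source H (γ t₀))))))
      refine ContDiffAt.contMDiffAt ?_
      refine ContDiffOn.contDiffAt ?_ (huo.mem_nhds htu)
      rw [show ((n + 1 : ℕ) : ℕ∞ω) = n + 1 by push_cast; rfl, contDiffOn_succ_iff_deriv_of_isOpen huo]
      refine ⟨fun t ht ↦ ((hu t ht).1).differentiableAt.differentiableWithinAt, by simp, ?_⟩
      have h1 : ContMDiffOn 𝓘(ℝ, ℝ) I.tangent n (fun t ↦ (⟨γ t, v (γ t)⟩ : TangentBundle I M)) u :=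
        (hv.of_le (by exact_mod_cast le_top)).comp (ih.mono fun t ht ↦ (hu t ht).2.1)
          (fun t ht ↦ hγU t (hu t ht).2.1)
      intro t ht
      have h2 := (Bundle.Trivialization.contMDiffWithinAt_iff (IB := I) (E := (TangentSpace I : M → Type _))
        (e := trivializationAt E (TangentSpace I) (γ t₀)) (by
          simpa using (hu t ht).2.2)).1 (h1 t ht)
      refine h2.2.contDiffWithinAt.congr (fun t ht ↦ ?_) ?_
      · rw [(hu t ht).1.deriv]
        rfl
      · rw [(hu t ht).1.deriv]
        rfl
  exact contMDiffOn_infty.2 main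

end IntegralCurve

/-! ### The tangent bundle of `G/H` parametrized by `G × T_o(G/H)` -/

section Homogeneous

variable {E F G : Type*} [NormedAddCommGroup E] [NormedSpace ℝ E]
  [NormedAddCommGroup F] [NormedSpace ℝ F]
  [TopologicalSpace G] [ChartedSpace E G] [Group G] [LieGroup 𝓘(ℝ, E) ∞ G]
  {H : Subgroup G} [ChartedSpace F (G ⧸ H)] [IsManifold 𝓘(ℝ, F) ∞ (G ⧸ H)]

instance isManifold_of_lieGroup : IsManifold 𝓘(ℝ, E) ∞ G := LieGroup.toContMDiffMul.toIsManifold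

/-- With a local section `s` of the projection, the action is locally `(g, x) ↦ π(g s(x))`. -/
theorem contMDiff_smul_quotient (hπ : Manifold.IsSubmersion 𝓘(ℝ, E) 𝓘(ℝ, F) ∞ (proj H)) :
    ContMDiff (𝓘(ℝ, E).prod 𝓘(ℝ, F)) 𝓘(ℝ, F) ∞ (fun q : G × (G ⧸ H) ↦ q.1 • q.2) := by
  rintro ⟨g, x⟩
  obtain ⟨k, rfl⟩ := QuotientGroup.mk_surjective x
  obtain ⟨U, hU, hkU, s, hs, hsk, hps⟩ := exists_local_section (hπ.isSubmersionAt k)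
  have h1 : ContMDiffAt (𝓘(ℝ, E).prod 𝓘(ℝ, F)) 𝓘(ℝ, E) ∞ (fun q : G × (G ⧸ H) ↦ s q.2)
      (g, QuotientGroup.mk k) :=
    ContMDiffAt.comp (f := Prod.snd) (g := s) _ (hs.contMDiffAt (hU.mem_nhds hkU)) contMDiffAt_snd
  refine (hπ.contMDiff.contMDiffAt.comp _ (contMDiffAt_fst.mul h1)).congr_of_eventuallyEq ?_
  have h2 : ∀ᶠ q : G × (G ⧸ H) in 𝓝 (g, QuotientGroup.mk k), q.2 ∈ U :=
    continuous_snd.continuousAt.eventually (hU.mem_nhds hkU)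
  filter_upwards [h2] with q hq
  rw [Function.comp_apply]
  change q.1 • q.2 = q.1 • proj H (s q.2)
  rw [hps _ hq]

/-- The action of the group on the tangent bundle of the coset space. -/
def push (g : G) (p : TangentBundle 𝓘(ℝ, F) (G ⧸ H)) : TangentBundle 𝓘(ℝ, F) (G ⧸ H) :=
  tangentMap 𝓘(ℝ, F) 𝓘(ℝ, F) (fun x : G ⧸ H ↦ g • x) p

theorem contMDiff_push (hπ : Manifold.IsSubmersion 𝓘(ℝ, E) 𝓘(ℝ, F) ∞ (proj H)) :
    ContMDiff (𝓘(ℝ, E).prod 𝓘(ℝ, F).tangent) 𝓘(ℝ, F).tangent ∞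
      (fun q : G × TangentBundle 𝓘(ℝ, F) (G ⧸ H) ↦ push q.1 q.2) :=
  contMDiff_tangentMap_param (contMDiff_smul_quotient hπ)

theorem contMDiff_push_left (hπ : Manifold.IsSubmersion 𝓘(ℝ, E) 𝓘(ℝ, F) ∞ (proj H)) (g : G) :
    ContMDiff 𝓘(ℝ, F).tangent 𝓘(ℝ, F).tangent ∞ (push (F := F) (H := H) g) :=
  (contMDiff_push hπ).comp (contMDiff_const.prodMk contMDiff_id)

theorem contMDiff_smul_left (hπ : Manifold.IsSubmersion 𝓘(ℝ, E) 𝓘(ℝ, F) ∞ (proj H)) (g : G) :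
    ContMDiff 𝓘(ℝ, F) 𝓘(ℝ, F) ∞ (fun x : G ⧸ H ↦ g • x) :=
  (contMDiff_smul_quotient hπ).comp (contMDiff_const.prodMk contMDiff_id)

theorem push_mul (hπ : Manifold.IsSubmersion 𝓘(ℝ, E) 𝓘(ℝ, F) ∞ (proj H)) (g k : G)
    (p : TangentBundle 𝓘(ℝ, F) (G ⧸ H)) : push (g * k) p = push g (push k p) := by
  have h : (fun x : G ⧸ H ↦ (g * k) • x) = (fun x ↦ g • x) ∘ fun x ↦ k • x := by
    ext x; exact mul_smul g k x
  rw [push, h, tangentMap_comp ((contMDiff_smul_left hπ g).mdifferentiable (by simp))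
    ((contMDiff_smul_left hπ k).mdifferentiable (by simp))]
  rfl

theorem push_one (p : TangentBundle 𝓘(ℝ, F) (G ⧸ H)) : push (1 : G) p = p := by
  have h : (fun x : G ⧸ H ↦ (1 : G) • x) = id := by ext x; exact one_smul G x
  rw [push, h, tangentMap_id]; rfl

/-- The differential of `x ↦ g • x` at the base point. -/
def baseDeriv (H : Subgroup G) [ChartedSpace F (G ⧸ H)] (g : G) : F →L[ℝ] F :=
  modelDeriv 𝓘(ℝ, F) 𝓘(ℝ, F) (fun x : G ⧸ H ↦ g • x) (proj H 1)

/-- The parametrization `(g, v) ↦ g_* v` of the tangent bundle by `G × T_o(G/H)`. -/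
def frameMap (H : Subgroup G) [ChartedSpace F (G ⧸ H)] (q : G × F) :
    TangentBundle 𝓘(ℝ, F) (G ⧸ H) :=
  fiberMk (proj H q.1) (baseDeriv H q.1 q.2)

theorem proj_eq_smul (g : G) : proj H g = g • proj H 1 :=
  (congrArg (proj H) (mul_one g)).symm

theorem smul_proj (g k : G) : g • proj H k = proj H (g * k) := rfl

theorem frameMap_eq_push (q : G × F) :
    frameMap H q = push q.1 (fiberMk (proj H 1) q.2) :=
  tangentBundle_ext (proj_eq_smul q.1) rfl

theorem contMDiff_frameMap (hπ : Manifold.IsSubmersion 𝓘(ℝ, E) 𝓘(ℝ, F) ∞ (proj H)) :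
    ContMDiff (𝓘(ℝ, E).prod 𝓘(ℝ, F)) 𝓘(ℝ, F).tangent ∞ (frameMap (F := F) H) := by
  have h := (contMDiff_push hπ).comp
    ((contMDiff_fst (I := 𝓘(ℝ, E)) (J := 𝓘(ℝ, F)) (M := G) (N := F)).prodMk
      ((contMDiff_fiberMk (F := F) (proj H 1)).comp contMDiff_snd))
  refine h.congr fun q ↦ ?_
  rw [frameMap_eq_push]; rfl

theorem push_frameMap (hπ : Manifold.IsSubmersion 𝓘(ℝ, E) 𝓘(ℝ, F) ∞ (proj H)) (a : G)
    (q : G × F) : push a (frameMap H q) = frameMap H (a * q.1, q.2) := by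
  rw [frameMap_eq_push, frameMap_eq_push, ← push_mul hπ]

/-- The component of `p` in the frame transported by `g`. -/
def frameVec (g : G) (p : TangentBundle 𝓘(ℝ, F) (G ⧸ H)) : F := fiberVec (push g⁻¹ p)

theorem frameMap_frameVec (hπ : Manifold.IsSubmersion 𝓘(ℝ, E) 𝓘(ℝ, F) ∞ (proj H)) (g : G)
    (p : TangentBundle 𝓘(ℝ, F) (G ⧸ H)) (hp : proj H g = p.1) :
    frameMap H (g, frameVec g p) = p := by
  have h : fiberMk (proj H 1) (frameVec g p) = push g⁻¹ p := by
    refine tangentBundle_ext ?_ rfl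
    change proj H 1 = g⁻¹ • p.1
    rw [← hp, smul_proj, inv_mul_cancel]
  rw [frameMap_eq_push, h, ← push_mul hπ, mul_inv_cancel, push_one]

theorem frameMap_one (v : F) : frameMap H (1, v) = fiberMk (proj H 1) v := by
  rw [frameMap_eq_push, push_one]

theorem frameVec_frameMap (hπ : Manifold.IsSubmersion 𝓘(ℝ, E) 𝓘(ℝ, F) ∞ (proj H)) (q : G × F) :
    frameVec q.1 (frameMap H q) = q.2 := by
  rw [frameVec, push_frameMap hπ, inv_mul_cancel, frameMap_one]
  rfl

theorem contMDiffOn_frameVec (hπ : Manifold.IsSubmersion 𝓘(ℝ, E) 𝓘(ℝ, F) ∞ (proj H)) :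
    ContMDiffOn (𝓘(ℝ, E).prod 𝓘(ℝ, F).tangent) 𝓘(ℝ, F) ∞
      (fun q : G × TangentBundle 𝓘(ℝ, F) (G ⧸ H) ↦ frameVec q.1 q.2)
      {q | proj H q.1 = q.2.1} := by
  have h1 : ContMDiff (𝓘(ℝ, E).prod 𝓘(ℝ, F).tangent) 𝓘(ℝ, F).tangent ∞
      (fun q : G × TangentBundle 𝓘(ℝ, F) (G ⧸ H) ↦ push q.1⁻¹ q.2) :=
    (contMDiff_push hπ).comp (contMDiff_fst.inv.prodMk contMDiff_snd)
  refine contMDiffOn_of_fiberMk (proj H 1) (h1.contMDiffOn.congr fun q hq ↦ ?_)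
  refine tangentBundle_ext ?_ rfl
  change proj H 1 = q.1⁻¹ • q.2.1
  rw [← show proj H q.1 = q.2.1 from hq, smul_proj, inv_mul_cancel]

/-- Local smooth sections of the parametrization of the tangent bundle. -/
theorem exists_section_frameMap (hπ : Manifold.IsSubmersion 𝓘(ℝ, E) 𝓘(ℝ, F) ∞ (proj H))
    (p : TangentBundle 𝓘(ℝ, F) (G ⧸ H)) :
    ∃ U ∈ 𝓝 p, ∃ s : TangentBundle 𝓘(ℝ, F) (G ⧸ H) → G × F,
      ContMDiffOn 𝓘(ℝ, F).tangent (𝓘(ℝ, E).prod 𝓘(ℝ, F)) ∞ s U ∧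
      ∀ z ∈ U, frameMap H (s z) = z := by
  obtain ⟨x, v⟩ := p
  obtain ⟨g, rfl⟩ := QuotientGroup.mk_surjective x
  obtain ⟨U, hU, hgU, σ, hσ, hσg, hpσ⟩ := exists_local_section (hπ.isSubmersionAt g)
  have h1 : ContMDiffOn 𝓘(ℝ, F).tangent 𝓘(ℝ, E) ∞
      (fun z : TangentBundle 𝓘(ℝ, F) (G ⧸ H) ↦ σ z.1) {z | z.1 ∈ U} :=
    hσ.comp (Bundle.contMDiffOn_proj _) fun z hz ↦ hz
  refine ⟨_, (isOpen_preimage_proj (F := F) hU).mem_nhds hgU,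
    fun z ↦ (σ z.1, frameVec (σ z.1) z), ?_, fun z hz ↦ frameMap_frameVec hπ _ _ (hpσ _ hz)⟩
  exact h1.prodMk ((contMDiffOn_frameVec hπ).comp
    (h1.prodMk (contMDiffOn_id (I := 𝓘(ℝ, F).tangent))) fun z hz ↦ hpσ _ hz)

/-! ### Translations, the adjoint action and their effect on the parametrization -/

/-- The differential of a left translation at the identity. -/
def leftDeriv (g : G) : E →L[ℝ] E := modelDeriv 𝓘(ℝ, E) 𝓘(ℝ, E) (fun x : G ↦ g * x) 1

/-- The differential of an inner automorphism at the identity. -/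
def adDeriv (g : G) : E →L[ℝ] E := modelDeriv 𝓘(ℝ, E) 𝓘(ℝ, E) (fun x : G ↦ g * x * g⁻¹) 1

variable (E) in
/-- The differential of the projection at the identity. -/
def projDeriv (H : Subgroup G) [ChartedSpace F (G ⧸ H)] : E →L[ℝ] F :=
  modelDeriv 𝓘(ℝ, E) 𝓘(ℝ, F) (proj H) 1

theorem hasModelDerivAt_mul_left (g k : G) :
    HasModelDerivAt 𝓘(ℝ, E) 𝓘(ℝ, E) (fun x : G ↦ g * x) k
      (modelDeriv 𝓘(ℝ, E) 𝓘(ℝ, E) (fun x : G ↦ g * x) k) :=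
  (contMDiff_mul_left (I := 𝓘(ℝ, E)) (n := ∞)).contMDiffAt.hasModelDerivAt

theorem hasModelDerivAt_mul_right (g k : G) :
    HasModelDerivAt 𝓘(ℝ, E) 𝓘(ℝ, E) (fun x : G ↦ x * g) k
      (modelDeriv 𝓘(ℝ, E) 𝓘(ℝ, E) (fun x : G ↦ x * g) k) :=
  (contMDiff_mul_right (I := 𝓘(ℝ, E)) (n := ∞)).contMDiffAt.hasModelDerivAt

theorem hasModelDerivAt_conj (g k : G) :
    HasModelDerivAt 𝓘(ℝ, E) 𝓘(ℝ, E) (fun x : G ↦ g * x * g⁻¹) k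
      (modelDeriv 𝓘(ℝ, E) 𝓘(ℝ, E) (fun x : G ↦ g * x * g⁻¹) k) :=
  ((contMDiff_mul_left (I := 𝓘(ℝ, E)) (n := ∞)).mul contMDiff_const).contMDiffAt.hasModelDerivAt

theorem modelDeriv_mul_left_leftDeriv (a g : G) (ξ : E) :
    modelDeriv 𝓘(ℝ, E) 𝓘(ℝ, E) (fun x : G ↦ a * x) g (leftDeriv g ξ) = leftDeriv (a * g) ξ := by
  have h1 := (hasModelDerivAt_mul_left (E := E) a g).comp_of_eq
    (hasModelDerivAt_mul_left (E := E) g 1) (mul_one g)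
  simp only [← mul_assoc] at h1
  exact (DFunLike.congr_fun h1.modelDeriv ξ).symm

theorem leftDeriv_one (ξ : E) : leftDeriv (1 : G) ξ = ξ := by
  have h : HasModelDerivAt 𝓘(ℝ, E) 𝓘(ℝ, E) (fun x : G ↦ 1 * x) 1 (ContinuousLinearMap.id ℝ E) := by
    simpa only [one_mul] using hasModelDerivAt_id (I := 𝓘(ℝ, E)) (1 : G)
  exact DFunLike.congr_fun h.modelDeriv ξ

/-- Differentiate `g z h⁻¹ = (g h⁻¹)(h z h⁻¹)` at `z = 1`. -/
theorem modelDeriv_mul_right_leftDeriv (g h : G) (ξ : E) :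
    modelDeriv 𝓘(ℝ, E) 𝓘(ℝ, E) (fun x : G ↦ x * h⁻¹) g (leftDeriv g ξ) =
      leftDeriv (g * h⁻¹) (adDeriv h ξ) := by
  have h1 := (hasModelDerivAt_mul_right (E := E) h⁻¹ g).comp_of_eq
    (hasModelDerivAt_mul_left (E := E) g 1) (mul_one g)
  have h2 := (hasModelDerivAt_mul_left (E := E) (g * h⁻¹) 1).comp_of_eq
    (hasModelDerivAt_conj (E := E) h 1) (by group)
  have h3 : (fun z : G ↦ g * h⁻¹ * (h * z * h⁻¹)) = fun z ↦ g * z * h⁻¹ := by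
    ext z; group
  rw [h3] at h2
  exact DFunLike.congr_fun (h1.unique h2) ξ

theorem hasModelDerivAt_smul (hπ : Manifold.IsSubmersion 𝓘(ℝ, E) 𝓘(ℝ, F) ∞ (proj H)) (g : G)
    (x : G ⧸ H) : HasModelDerivAt 𝓘(ℝ, F) 𝓘(ℝ, F) (fun x : G ⧸ H ↦ g • x) x
      (modelDeriv 𝓘(ℝ, F) 𝓘(ℝ, F) (fun x : G ⧸ H ↦ g • x) x) :=
  (contMDiff_smul_left hπ g).contMDiffAt.hasModelDerivAt

theorem hasModelDerivAt_proj (hπ : Manifold.IsSubmersion 𝓘(ℝ, E) 𝓘(ℝ, F) ∞ (proj H)) (g : G) :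
    HasModelDerivAt 𝓘(ℝ, E) 𝓘(ℝ, F) (proj H) g (modelDeriv 𝓘(ℝ, E) 𝓘(ℝ, F) (proj H) g) :=
  hπ.contMDiff.contMDiffAt.hasModelDerivAt

theorem modelDeriv_proj_leftDeriv (hπ : Manifold.IsSubmersion 𝓘(ℝ, E) 𝓘(ℝ, F) ∞ (proj H)) (g : G)
    (ξ : E) :
    modelDeriv 𝓘(ℝ, E) 𝓘(ℝ, F) (proj H) g (leftDeriv g ξ) = baseDeriv H g (projDeriv E H ξ) := by
  have h1 := (hasModelDerivAt_proj hπ g).comp_of_eq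
    (hasModelDerivAt_mul_left (E := E) g 1) (mul_one g)
  have h2 := (hasModelDerivAt_smul hπ g _).comp (hasModelDerivAt_proj hπ 1)
  exact DFunLike.congr_fun (h1.unique h2) ξ

/-- For `h ∈ H` the trailing `h⁻¹` is absorbed by the coset: `π(h z h⁻¹) = h · π(z)`. Hence `π_*`
intertwines `Ad(h)` with the isotropy representation. -/
theorem projDeriv_adDeriv (hπ : Manifold.IsSubmersion 𝓘(ℝ, E) 𝓘(ℝ, F) ∞ (proj H)) {h : G}
    (hh : h ∈ H) (ξ : E) :
    projDeriv E H (adDeriv h ξ) = baseDeriv H h (projDeriv (F := F) E H ξ) := by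
  have h1 := (hasModelDerivAt_proj hπ 1).comp_of_eq
    (hasModelDerivAt_conj (E := E) h 1) (by group)
  have h2 := (hasModelDerivAt_smul hπ h _).comp (hasModelDerivAt_proj hπ 1)
  have h3 : (fun z : G ↦ proj H (h * z * h⁻¹)) = fun z ↦ h • proj H z := by
    ext z
    exact (QuotientGroup.mk_mul_of_mem (h * z) (H.inv_mem hh))
  rw [h3] at h1
  exact DFunLike.congr_fun (h1.unique h2) ξ

theorem proj_of_mem {h : G} (hh : h ∈ H) : proj H h = proj H 1 := by
  have := QuotientGroup.mk_mul_of_mem (1 : G) hh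
  rwa [one_mul] at this

/-- Moving an element of `H` from the group factor to the fibre factor does not change the tangent
vector; this describes the fibres of `frameMap`. -/
theorem frameMap_mul (hπ : Manifold.IsSubmersion 𝓘(ℝ, E) 𝓘(ℝ, F) ∞ (proj H)) {h : G}
    (hh : h ∈ H) (g : G) (v : F) : frameMap H (g * h, v) = frameMap H (g, baseDeriv H h v) := by
  rw [← push_frameMap hπ g (h, v), frameMap_eq_push (g, _)]
  have : frameMap H (h, v) = fiberMk (proj H 1) (baseDeriv H h v) :=
    tangentBundle_ext (proj_of_mem hh) rfl
  rw [this]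

theorem baseDeriv_one (v : F) : baseDeriv H 1 v = v :=
  congrArg fiberVec (frameMap_one (H := H) v)

theorem baseDeriv_mul (hπ : Manifold.IsSubmersion 𝓘(ℝ, E) 𝓘(ℝ, F) ∞ (proj H)) {h : G}
    (hh : h ∈ H) (g : G) (v : F) : baseDeriv H (g * h) v = baseDeriv H g (baseDeriv H h v) :=
  congrArg fiberVec (frameMap_mul hπ hh g v)

theorem baseDeriv_injective (hπ : Manifold.IsSubmersion 𝓘(ℝ, E) 𝓘(ℝ, F) ∞ (proj H)) (g : G) :
    Function.Injective (baseDeriv (F := F) H g) := by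
  intro v w hvw
  have h1 : frameMap H (g, v) = frameMap H (g, w) := congrArg (fiberMk (proj H g)) hvw
  have h2 := frameVec_frameMap hπ (g, v)
  rw [h1] at h2
  exact h2.symm.trans (frameVec_frameMap hπ (g, w))

theorem frameMap_mem_slit (hπ : Manifold.IsSubmersion 𝓘(ℝ, E) 𝓘(ℝ, F) ∞ (proj H)) {q : G × F} :
    frameMap H q ∈ slit F (G ⧸ H) ↔ q.2 ≠ 0 := by
  change baseDeriv H q.1 q.2 ≠ 0 ↔ _
  rw [not_iff_not, map_eq_zero_iff _ (baseDeriv_injective hπ q.1)]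

/-- The differential of the parametrization of the tangent bundle. -/
def frameDeriv (H : Subgroup G) [ChartedSpace F (G ⧸ H)] [IsManifold 𝓘(ℝ, F) ∞ (G ⧸ H)]
    (q : G × F) : E × F →L[ℝ] F × F :=
  modelDeriv (𝓘(ℝ, E).prod 𝓘(ℝ, F)) 𝓘(ℝ, F).tangent (frameMap H) q

theorem hasModelDerivAt_frameMap (hπ : Manifold.IsSubmersion 𝓘(ℝ, E) 𝓘(ℝ, F) ∞ (proj H))
    (q : G × F) : HasModelDerivAt (𝓘(ℝ, E).prod 𝓘(ℝ, F)) 𝓘(ℝ, F).tangent (frameMap H) q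
      (frameDeriv (E := E) H q) :=
  (contMDiff_frameMap hπ).contMDiffAt.hasModelDerivAt

theorem frameDeriv_vertical (hπ : Manifold.IsSubmersion 𝓘(ℝ, E) 𝓘(ℝ, F) ∞ (proj H))
    (q : G × F) (w : F) :
    frameDeriv H q ((0 : E), w) = verticalLift (frameMap H q) (baseDeriv H q.1 w : F) := by
  have h1 := (hasModelDerivAt_frameMap hπ q).comp_of_eq ((hasModelDerivAt_const (I := 𝓘(ℝ, F))
    (J := 𝓘(ℝ, E)) q.1 q.2).prodMk (hasModelDerivAt_id (I := 𝓘(ℝ, F)) q.2)) rfl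
  have h2 := ContMDiffAt.hasModelDerivAt
    (contMDiff_fiberMk (F := F) (proj H q.1) (baseDeriv H q.1 q.2)) |>.comp
    ((baseDeriv H q.1).hasFDerivAt (x := q.2)).hasModelDerivAt
  rw [verticalLift_eq]
  exact DFunLike.congr_fun (h1.unique h2) w

theorem modelDeriv_tangentProj_frameDeriv
    (hπ : Manifold.IsSubmersion 𝓘(ℝ, E) 𝓘(ℝ, F) ∞ (proj H)) (q : G × F) (ξ : E × F) :
    modelDeriv 𝓘(ℝ, F).tangent 𝓘(ℝ, F) (fun p : TangentBundle 𝓘(ℝ, F) (G ⧸ H) ↦ p.1)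
      (frameMap H q) (frameDeriv H q ξ) = modelDeriv 𝓘(ℝ, E) 𝓘(ℝ, F) (proj H) q.1 ξ.1 := by
  have h1 := ((Bundle.contMDiff_proj (TangentSpace 𝓘(ℝ, F) : G ⧸ H → Type _) (n := ∞)
    (frameMap H q))).hasModelDerivAt.comp (hasModelDerivAt_frameMap hπ q)
  have h2 : HasModelDerivAt (𝓘(ℝ, E).prod 𝓘(ℝ, F)) 𝓘(ℝ, E) (fun z : G × F ↦ z.1) q
    (ContinuousLinearMap.fst ℝ E F) := hasMFDerivAt_fst q
  exact DFunLike.congr_fun (h1.unique ((hasModelDerivAt_proj hπ q.1).comp h2)) ξ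

/-! ### Vector fields upstairs and relatedness -/

/-- The vector field `(g, v) ↦ ((L_g)_* b(v), - ζ(v))` on `G × T_o(G/H)`. -/
def frameField (b : F →L[ℝ] E) (ζ : F → F) (q : G × F) : E × F :=
  (leftDeriv q.1 (b q.2), -ζ q.2)

/-- Differentiated form of the equivariance `a_* (frameMap (g, v)) = frameMap (a g, v)`. -/
theorem frameDeriv_left (hπ : Manifold.IsSubmersion 𝓘(ℝ, E) 𝓘(ℝ, F) ∞ (proj H)) (a : G)
    (q : G × F) (ξ : E) (w : F) :
    modelDeriv 𝓘(ℝ, F).tangent 𝓘(ℝ, F).tangent (push a) (frameMap H q)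
      (frameDeriv H q (leftDeriv q.1 ξ, w)) =
      frameDeriv H (a * q.1, q.2) (leftDeriv (a * q.1) ξ, w) := by
  have hf : HasModelDerivAt (𝓘(ℝ, E).prod 𝓘(ℝ, F)) 𝓘(ℝ, E) (fun z : G × F ↦ z.1) q
    (ContinuousLinearMap.fst ℝ E F) := hasMFDerivAt_fst q
  have hs : HasModelDerivAt (𝓘(ℝ, E).prod 𝓘(ℝ, F)) 𝓘(ℝ, F) (fun z : G × F ↦ z.2) q
    (ContinuousLinearMap.snd ℝ E F) := hasMFDerivAt_snd q
  have h1 := (contMDiff_push_left hπ a (frameMap H q)).hasModelDerivAt.comp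
    (hasModelDerivAt_frameMap hπ q)
  have h2 := (hasModelDerivAt_frameMap hπ (a * q.1, q.2)).comp_of_eq
    (((hasModelDerivAt_mul_left a q.1).comp hf).prodMk hs) rfl
  simp only [push_frameMap hπ] at h1
  refine (DFunLike.congr_fun (h1.unique h2) (leftDeriv q.1 ξ, w)).trans ?_
  rw [ContinuousLinearMap.comp_apply, ContinuousLinearMap.prod_apply,
    ContinuousLinearMap.comp_apply, ← modelDeriv_mul_left_leftDeriv a q.1 ξ]
  rfl

/-- Differentiated form of the invariance of `frameMap` under `(g, v) ↦ (g h⁻¹, h_* v)`. It is what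
makes a field upstairs compatible with a change of coset representative. -/
theorem frameDeriv_right (hπ : Manifold.IsSubmersion 𝓘(ℝ, E) 𝓘(ℝ, F) ∞ (proj H)) {h : G}
    (hh : h ∈ H) (q : G × F) (ξ : E) (w : F) :
    frameDeriv H (q.1 * h⁻¹, baseDeriv H h q.2)
      (leftDeriv (q.1 * h⁻¹) (adDeriv h ξ), baseDeriv H h w) =
      frameDeriv H q (leftDeriv q.1 ξ, w) := by
  have hf : HasModelDerivAt (𝓘(ℝ, E).prod 𝓘(ℝ, F)) 𝓘(ℝ, E) (fun z : G × F ↦ z.1) q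
    (ContinuousLinearMap.fst ℝ E F) := hasMFDerivAt_fst q
  have hs : HasModelDerivAt (𝓘(ℝ, E).prod 𝓘(ℝ, F)) 𝓘(ℝ, F) (fun z : G × F ↦ z.2) q
    (ContinuousLinearMap.snd ℝ E F) := hasMFDerivAt_snd q
  have h2 := (hasModelDerivAt_frameMap hπ (q.1 * h⁻¹, baseDeriv H h q.2)).comp_of_eq
    (((hasModelDerivAt_mul_right h⁻¹ q.1).comp hf).prodMk
      ((baseDeriv H h).hasFDerivAt.hasModelDerivAt.comp hs)) rfl
  have h3 : (fun z : G × F ↦ frameMap H (z.1 * h⁻¹, baseDeriv H h z.2)) = frameMap H := by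
    ext1 z
    rw [← frameMap_mul hπ hh, inv_mul_cancel_right]
  rw [h3] at h2
  refine Eq.trans ?_ (DFunLike.congr_fun (h2.unique (hasModelDerivAt_frameMap hπ q))
    (leftDeriv q.1 ξ, w))
  rw [ContinuousLinearMap.comp_apply, ContinuousLinearMap.prod_apply,
    ContinuousLinearMap.comp_apply, ContinuousLinearMap.comp_apply,
    ← modelDeriv_mul_right_leftDeriv]
  rfl

/-- The fibre component of the parametrization in standard coordinates. -/
def frameCoord (H : Subgroup G) [ChartedSpace F (G ⧸ H)] (e : OpenPartialHomeomorph (G ⧸ H) F)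
    (q : G × F) : F := (stdCoord e (frameMap H q)).2

theorem hasModelDerivAt_frameCoord (hπ : Manifold.IsSubmersion 𝓘(ℝ, E) 𝓘(ℝ, F) ∞ (proj H))
    {e : OpenPartialHomeomorph (G ⧸ H) F} (he : e ∈ IsManifold.maximalAtlas 𝓘(ℝ, F) ∞ (G ⧸ H))
    {q : G × F} (hq : proj H q.1 ∈ e.source) :
    HasModelDerivAt (𝓘(ℝ, E).prod 𝓘(ℝ, F)) 𝓘(ℝ, F) (frameCoord H e) q
      ((ContinuousLinearMap.snd ℝ F F).comp ((modelDeriv 𝓘(ℝ, F).tangent 𝓘(ℝ, F × F) (stdCoord e)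
        (frameMap H q)).comp (frameDeriv H q))) := by
  have h1 := (mdifferentiableAt_stdCoord he (p := frameMap H q) hq).hasModelDerivAt.comp
    (hasModelDerivAt_frameMap hπ q)
  exact (ContinuousLinearMap.snd ℝ F F).hasFDerivAt.hasModelDerivAt.comp h1

theorem frameCoord_eq (e : OpenPartialHomeomorph (G ⧸ H) F) (q : G × F) :
    frameCoord H e q =
      modelDeriv 𝓘(ℝ, F) 𝓘(ℝ, F) e (proj H q.1) (baseDeriv H q.1 q.2) := rfl

theorem frameCoord_smul (e : OpenPartialHomeomorph (G ⧸ H) F) (g : G) (r : ℝ) (v : F) :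
    frameCoord H e (g, r • v) = r • frameCoord H e (g, v) := by
  simp only [frameCoord_eq, map_smul]

/-- The fibre component in standard coordinates of the image of a vector under the parametrization
scales quadratically. -/
theorem stdComponents_frameDeriv_smul
    (hπ : Manifold.IsSubmersion 𝓘(ℝ, E) 𝓘(ℝ, F) ∞ (proj H))
    {e : OpenPartialHomeomorph (G ⧸ H) F} (he : e ∈ IsManifold.maximalAtlas 𝓘(ℝ, F) ∞ (G ⧸ H))
    {q : G × F} (hq : proj H q.1 ∈ e.source) (r : ℝ) (ξ : E) (w : F) :
    (stdComponents e (frameMap H (q.1, r • q.2)) (frameDeriv H (q.1, r • q.2)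
      (r • ξ, r ^ 2 • w))).2 =
      r ^ 2 • (stdComponents e (frameMap H q) (frameDeriv H q (ξ, w))).2 := by
  have hf : HasModelDerivAt (𝓘(ℝ, E).prod 𝓘(ℝ, F)) 𝓘(ℝ, E) (fun z : G × F ↦ z.1) q
    (ContinuousLinearMap.fst ℝ E F) := hasMFDerivAt_fst q
  have hs : HasModelDerivAt (𝓘(ℝ, E).prod 𝓘(ℝ, F)) 𝓘(ℝ, F) (fun z : G × F ↦ z.2) q
    (ContinuousLinearMap.snd ℝ E F) := hasMFDerivAt_snd q
  have hr := ((r • ContinuousLinearMap.id ℝ F).hasFDerivAt (x := q.2)).hasModelDerivAt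
  have h1 := (hasModelDerivAt_frameCoord hπ he (q := (q.1, r • q.2)) hq).comp_of_eq
    (hf.prodMk (hr.comp hs)) rfl
  have hr' := ((r • ContinuousLinearMap.id ℝ F).hasFDerivAt (x := frameCoord H e q)).hasModelDerivAt
  have h2 := hr'.comp (hasModelDerivAt_frameCoord hπ he hq)
  have h3 : (fun z : G × F ↦ (r • ContinuousLinearMap.id ℝ F) (frameCoord H e z)) =
      fun z ↦ frameCoord H e (z.1, (r • ContinuousLinearMap.id ℝ F) z.2) := by
    ext1 z
    exact (frameCoord_smul e z.1 r z.2).symm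
  rw [h3] at h2
  have h6 := DFunLike.congr_fun (h1.unique h2) (ξ, w)
  -- One factor `r` is pulled out by linearity; the other is produced by the dilation of the fibre
  -- in `h6`.
  have h7 : ((r • ξ, r ^ 2 • w) : E × F) = r • (ξ, r • w) := by
    rw [Prod.smul_mk, smul_smul, pow_two]
  rw [h7, map_smul, pow_two, mul_smul]
  have h8 := congrArg (r • ·) h6
  refine Eq.trans ?_ h8
  exact congrArg Prod.snd ((modelDeriv 𝓘(ℝ, F).tangent 𝓘(ℝ, F × F) (stdCoord e)
    (frameMap H (q.1, r • q.2))).map_smul r _)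

/-- Smoothness of the vector fields on `G × T_o(G/H)`. -/
theorem contMDiffOn_frameField (b : F →L[ℝ] E) {ζ : F → F} {s : Set F} (hζ : ContDiffOn ℝ ∞ ζ s) :
    ContMDiffOn (𝓘(ℝ, E).prod 𝓘(ℝ, F)) (𝓘(ℝ, E).prod 𝓘(ℝ, F)).tangent ∞
      (fun q : G × F ↦ (⟨q, frameField b ζ q⟩ : TangentBundle (𝓘(ℝ, E).prod 𝓘(ℝ, F)) (G × F)))
      {q | q.2 ∈ s} := by
  have h1 : ContMDiff (𝓘(ℝ, E).prod 𝓘(ℝ, F)) 𝓘(ℝ, E).tangent ∞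
      (fun q : G × F ↦ fiberMk q.1 (leftDeriv q.1 (b q.2))) := by
    have h := (contMDiff_tangentMap_param (contMDiff_mul 𝓘(ℝ, E) ∞ (G := G))).comp
      ((contMDiff_fst (I := 𝓘(ℝ, E)) (J := 𝓘(ℝ, F)) (M := G) (N := F)).prodMk
      (((contMDiff_fiberMk (F := E) (1 : G)).comp b.contDiff.contMDiff).comp contMDiff_snd))
    refine h.congr fun q ↦ ?_
    exact tangentBundle_ext (mul_one q.1).symm rfl
  have h2 : ContMDiffOn (𝓘(ℝ, E).prod 𝓘(ℝ, F)) 𝓘(ℝ, F).tangent ∞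
      (fun q : G × F ↦ (⟨q.2, -ζ q.2⟩ : TangentBundle 𝓘(ℝ, F) F)) {q | q.2 ∈ s} :=
    (contMDiff_tangentBundle_mk.comp_contMDiffOn
      (contDiffOn_id.prodMk hζ.neg).contMDiffOn).comp contMDiff_snd.contMDiffOn fun q hq ↦ hq
  exact (contMDiff_equivTangentBundleProd_symm (I := 𝓘(ℝ, E)) (M := G) (I' := 𝓘(ℝ, F))
    (M' := F) (n := ∞)).comp_contMDiffOn (h1.contMDiffOn.prodMk h2)

/-- `b` identifies the tangent space at the base point with an `Ad(H)`-invariant complement of the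
isotropy algebra. -/
structure IsHorizontalSection (H : Subgroup G) [ChartedSpace F (G ⧸ H)] (b : F →L[ℝ] E) : Prop where
  right_inv : ∀ v, projDeriv E H (b v) = v
  equivariant : ∀ h ∈ H, ∀ v, b (baseDeriv H h v) = adDeriv h (b v)

/-- Positively 2-homogeneous smooth maps on `T_o(G/H)` invariant under the isotropy
representation. -/
structure IsIsotropyInvariant (H : Subgroup G) [ChartedSpace F (G ⧸ H)] (ζ : F → F) : Prop where
  smooth : ContDiffOn ℝ ∞ ζ {0}ᶜ
  zero_off : ζ 0 = 0
  homogeneous : ∀ r : ℝ, 0 < r → ∀ v : F, v ≠ 0 → ζ (r • v) = r ^ 2 • ζ v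
  invariant : ∀ h ∈ H, ∀ v : F, v ≠ 0 → ζ (baseDeriv H h v) = baseDeriv H h (ζ v)

/-- The value of a field, regarded as an element of the model space. -/
def fieldVec {M : Type*} [TopologicalSpace M] [ChartedSpace F M] [IsManifold 𝓘(ℝ, F) ∞ M]
    (W : TangentBundleField F M) (p : TangentBundle 𝓘(ℝ, F) M) : F × F := W p

/-- `W` is the image of the vector field `frameField b ζ` under the parametrization of the tangent
bundle. -/
def IsRelatedField (b : F →L[ℝ] E) (ζ : F → F) (W : TangentBundleField F (G ⧸ H)) : Prop :=
  ∀ q : G × F, q.2 ≠ 0 → fieldVec W (frameMap H q) = frameDeriv H q (frameField b ζ q)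

/-- The difference of the two arguments is vertical, and vertical vectors map injectively to
vertical lifts. Since `frameDeriv` kills the directions of the `H`-action, a lifted field has a
unique second entry only after its first entry is fixed. -/
theorem frameDeriv_injective_right (hπ : Manifold.IsSubmersion 𝓘(ℝ, E) 𝓘(ℝ, F) ∞ (proj H))
    {q : G × F} {ξ : E} {w z : F} (h : frameDeriv H q (ξ, w) = frameDeriv H q (ξ, z)) : w = z := by
  have h1 : frameDeriv H q ((0 : E), w) = frameDeriv H q ((0 : E), z) := by
    have hw : ((0 : E), w) = (ξ, w) - (ξ, 0) := by simp
    have hz : ((0 : E), z) = (ξ, z) - (ξ, 0) := by simp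
    rw [hw, hz, map_sub, map_sub, h]
  rw [frameDeriv_vertical hπ, frameDeriv_vertical hπ] at h1
  exact baseDeriv_injective hπ q.1 (verticalLift_injective _ h1)

theorem IsHorizontalSection.modelDeriv_proj {b : F →L[ℝ] E} (hb : IsHorizontalSection H b)
    (hπ : Manifold.IsSubmersion 𝓘(ℝ, E) 𝓘(ℝ, F) ∞ (proj H)) (q : G × F) :
    modelDeriv 𝓘(ℝ, E) 𝓘(ℝ, F) (proj H) q.1 (leftDeriv q.1 (b q.2)) = baseDeriv H q.1 q.2 := by
  rw [modelDeriv_proj_leftDeriv hπ, hb.right_inv]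

/-- Taking components in a standard frame, as a map between the model spaces. -/
def compDeriv {M : Type*} [TopologicalSpace M] [ChartedSpace F M] [IsManifold 𝓘(ℝ, F) ∞ M]
    (e : OpenPartialHomeomorph M F) (p : TangentBundle 𝓘(ℝ, F) M) : F × F →L[ℝ] F × F :=
  modelDeriv 𝓘(ℝ, F).tangent 𝓘(ℝ, F × F) (stdCoord e) p

theorem compDeriv_injective {M : Type*} [TopologicalSpace M] [ChartedSpace F M]
    [IsManifold 𝓘(ℝ, F) ∞ M] {e : OpenPartialHomeomorph M F}
    (he : e ∈ IsManifold.maximalAtlas 𝓘(ℝ, F) ∞ M) {p : TangentBundle 𝓘(ℝ, F) M}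
    (hp : p.1 ∈ e.source) : Function.Injective (compDeriv e p) :=
  stdComponents_injective he hp

theorem compDeriv_frameDeriv_fst (hπ : Manifold.IsSubmersion 𝓘(ℝ, E) 𝓘(ℝ, F) ∞ (proj H))
    {e : OpenPartialHomeomorph (G ⧸ H) F} (he : e ∈ IsManifold.maximalAtlas 𝓘(ℝ, F) ∞ (G ⧸ H))
    {q : G × F} (hq : proj H q.1 ∈ e.source) (ξ : E × F) :
    (compDeriv e (frameMap H q) (frameDeriv H q ξ)).1 =
      modelDeriv 𝓘(ℝ, F) 𝓘(ℝ, F) e (proj H q.1)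
        (modelDeriv 𝓘(ℝ, E) 𝓘(ℝ, F) (proj H) q.1 ξ.1) := by
  rw [← modelDeriv_tangentProj_frameDeriv hπ]
  exact stdComponents_fst he (p := frameMap H q) hq _

/-- The `x`-component only sees the projection of `(L_g)_* b(v)` to `G/H`, which is `g_* v`, the
tangent vector at which it is taken. So every related field has the form `y ∂_x + …`. -/
theorem compDeriv_frameDeriv_horizontal_fst {b : F →L[ℝ] E} (hb : IsHorizontalSection H b)
    (hπ : Manifold.IsSubmersion 𝓘(ℝ, E) 𝓘(ℝ, F) ∞ (proj H))
    {e : OpenPartialHomeomorph (G ⧸ H) F} (he : e ∈ IsManifold.maximalAtlas 𝓘(ℝ, F) ∞ (G ⧸ H))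
    {q : G × F} (hq : proj H q.1 ∈ e.source) (w : F) :
    (compDeriv e (frameMap H q) (frameDeriv H q (leftDeriv q.1 (b q.2), w))).1 =
      (stdCoord e (frameMap H q)).2 := by
  rw [compDeriv_frameDeriv_fst hπ he hq]
  change modelDeriv 𝓘(ℝ, F) 𝓘(ℝ, F) e (proj H q.1)
        (modelDeriv 𝓘(ℝ, E) 𝓘(ℝ, F) (proj H) q.1 (leftDeriv q.1 (b q.2))) = _
  rw [hb.modelDeriv_proj hπ]
  rfl

theorem compDeriv_frameDeriv_vertical (hπ : Manifold.IsSubmersion 𝓘(ℝ, E) 𝓘(ℝ, F) ∞ (proj H))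
    {e : OpenPartialHomeomorph (G ⧸ H) F} (he : e ∈ IsManifold.maximalAtlas 𝓘(ℝ, F) ∞ (G ⧸ H))
    {q : G × F} (hq : proj H q.1 ∈ e.source) (w : F) :
    compDeriv e (frameMap H q) (frameDeriv H q ((0 : E), w)) =
      (0, modelDeriv 𝓘(ℝ, F) 𝓘(ℝ, F) e (proj H q.1) (baseDeriv H q.1 w)) := by
  rw [frameDeriv_vertical hπ]
  exact stdComponents_verticalLift he (p := frameMap H q) hq _

/-- Standard components depend smoothly on the tangent vector. -/
theorem contDiffOn_compDeriv {M : Type*} [TopologicalSpace M] [ChartedSpace F M]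
    [IsManifold 𝓘(ℝ, F) ∞ M] {e : OpenPartialHomeomorph M F}
    (he : e ∈ IsManifold.maximalAtlas 𝓘(ℝ, F) ∞ M) {s : Set F}
    {p : F → TangentBundle 𝓘(ℝ, F) M} {w : F → F × F} (hp : ∀ v ∈ s, (p v).1 ∈ e.source)
    (hw : ContMDiffOn 𝓘(ℝ, F) 𝓘(ℝ, F).tangent.tangent ∞
      (fun v ↦ (⟨p v, w v⟩ : TangentBundle 𝓘(ℝ, F).tangent (TangentBundle 𝓘(ℝ, F) M))) s) :
    ContDiffOn ℝ ∞ (fun v ↦ compDeriv e (p v) (w v)) s := by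
  have hO := isOpen_preimage_proj (F := F) e.open_source
  have h1 := (contMDiffOn_stdCoord he).contMDiffOn_tangentMapWithin (m := ∞) (by simp)
    hO.uniqueMDiffOn
  have h2 := (contMDiff_snd_tangentBundle_modelSpace (F × F) 𝓘(ℝ, F × F) (n := ∞)).comp_contMDiffOn
    (h1.comp hw fun v hv ↦ hp v hv)
  refine h2.contDiffOn.congr fun v hv ↦ ?_
  change mfderiv 𝓘(ℝ, F).tangent 𝓘(ℝ, F × F) (stdCoord e) (p v) (w v) =
    mfderivWithin 𝓘(ℝ, F).tangent 𝓘(ℝ, F × F) (stdCoord e) _ (p v) (w v)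
  rw [mfderivWithin_of_isOpen hO (hp v hv)]

theorem IsInvariantField.fieldVec_push {W : TangentBundleField F (G ⧸ H)}
    (hW : IsInvariantField G W) (g : G) {p : TangentBundle 𝓘(ℝ, F) (G ⧸ H)}
    (hp : p ∈ slit F (G ⧸ H)) :
    fieldVec W (push g p) =
      modelDeriv 𝓘(ℝ, F).tangent 𝓘(ℝ, F).tangent (push g) p (fieldVec W p) :=
  (hW g p hp).symm

/-! ### Invariant sprays correspond to isotropy-invariant maps -/

/-- Invariant sprays are related to vector fields on `G × T_o(G/H)`. -/
theorem exists_isRelatedField {b : F →L[ℝ] E} (hb : IsHorizontalSection H b)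
    (hπ : Manifold.IsSubmersion 𝓘(ℝ, E) 𝓘(ℝ, F) ∞ (proj H)) {W : TangentBundleField F (G ⧸ H)}
    (hW : IsSpray W) (hWi : IsInvariantField G W) :
    ∃ ζ : F → F, IsIsotropyInvariant H ζ ∧ IsRelatedField b ζ W := by
  classical
  set e := chartAt F (proj H 1 : G ⧸ H)
  have he := IsManifold.chart_mem_maximalAtlas (I := 𝓘(ℝ, F)) (n := ∞) (proj H 1 : G ⧸ H)
  have ho := mem_chart_source F (proj H 1 : G ⧸ H)
  obtain ⟨C, hC, hCh⟩ := hW.local_form e he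
  have hslit : ∀ {q : G × F}, q.2 ≠ 0 → frameMap H q ∈ slit F (G ⧸ H) :=
    fun h ↦ (frameMap_mem_slit hπ).2 h
  have hcomp : ∀ v : F, v ≠ 0 → compDeriv e (frameMap H (1, v)) (fieldVec W (frameMap H (1, v))) =
      (frameCoord H e (1, v), -((2 : ℝ) • C (e (proj H 1)) (frameCoord H e (1, v)))) :=
    fun v hv ↦ hC _ (hslit hv) ho
  have hex : ∀ v : F, ∃ z : F, v ≠ 0 → fieldVec W (frameMap H (1, v)) =
      frameDeriv H (1, v) (leftDeriv (1 : G) (b v), -z) := by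
    intro v
    by_cases hv : v = 0
    · exact ⟨0, fun h ↦ absurd hv h⟩
    -- Both vectors have `x`-component `y`, so their difference is vertical.
    obtain ⟨z, hz⟩ := exists_eq_verticalLift he (p := frameMap H (1, v)) ho
      (show F × F from fieldVec W (frameMap H (1, v)) -
        frameDeriv H (1, v) (leftDeriv (1 : G) (b v), (0 : F))) (by
        change (compDeriv e (frameMap H (1, v)) (fieldVec W (frameMap H (1, v)) -
          frameDeriv H (1, v) (leftDeriv (1 : G) (b v), (0 : F)))).1 = 0
        rw [map_sub, Prod.fst_sub, hcomp v hv,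
          compDeriv_frameDeriv_horizontal_fst hb hπ he (q := (1, v)) ho]
        exact sub_self _)
    refine ⟨-z, fun _ ↦ ?_⟩
    have h1 := frameDeriv_vertical hπ (1, v) z
    rw [baseDeriv_one] at h1
    have h2 : fieldVec W (frameMap H (1, v)) - frameDeriv H (1, v) (leftDeriv (1 : G) (b v), 0) =
      frameDeriv H (1, v) ((0 : E), z) := hz.trans h1.symm
    rw [sub_eq_iff_eq_add] at h2
    rw [h2, ← map_add, neg_neg]
    simp
  choose ζ₀ hζ₀ using hex
  -- At `0` the chosen value is arbitrary; it is reset to `0` to meet `zero_off`.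
  set ζ : F → F := fun v ↦ if v = 0 then 0 else ζ₀ v with hζdef
  have hζ : ∀ v : F, v ≠ 0 → fieldVec W (frameMap H (1, v)) =
      frameDeriv H (1, v) (leftDeriv (1 : G) (b v), -ζ v) := by
    intro v hv
    rw [hζdef]
    simp only [if_neg hv]
    exact hζ₀ v hv
  -- The identity over `o` is carried to `g · o` by invariance of `W` and left equivariance of the
  -- parametrization.
  have hrel : IsRelatedField b ζ W := by
    rintro ⟨g, v⟩ hv
    have h1 := hWi.fieldVec_push g (hslit (q := (1, v)) hv)
    rw [hζ v hv, frameDeriv_left hπ g (1, v), push_frameMap hπ, mul_one] at h1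
    exact h1
  refine ⟨ζ, ⟨?_, ?_, ?_, ?_⟩, hrel⟩
  -- Over `o`, `ζ` is the fibre part of the image of `frameField b 0` minus `W`, both smooth in a
  -- chart; `w` undoes the differential of the chart at `o`.
  · have h1 : ContDiffOn ℝ ∞ (fun v ↦ compDeriv e (frameMap H (1, v))
        (fieldVec W (frameMap H (1, v)))) {0}ᶜ := by
      refine contDiffOn_compDeriv he (fun v _ ↦ ho) ?_
      have h := hW.smooth.comp (contMDiff_fiberMk (F := F) (proj H 1)).contMDiffOn (s := {0}ᶜ)
        (fun v hv ↦ hv)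
      refine h.congr fun v hv ↦ ?_
      rw [frameMap_one]; rfl
    have h2 : ContDiffOn ℝ ∞ (fun v ↦ compDeriv e (frameMap H ((1 : G), v))
        (frameDeriv H ((1 : G), v) (frameField b 0 ((1 : G), v)))) {0}ᶜ := by
      refine contDiffOn_compDeriv he (fun v _ ↦ ho) ?_
      have h := ((contMDiff_frameMap hπ).contMDiff_tangentMap (m := ∞) (by simp)).comp_contMDiffOn
        (contMDiffOn_frameField (G := G) b (contDiff_const (c := (0 : F)).contDiffOn (s := univ)))
      exact h.comp ((contMDiff_const (c := (1 : G))).prodMk contMDiff_id).contMDiffOn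
        fun v _ ↦ mem_univ _
    obtain ⟨w, hw⟩ : ∃ w : F →L[ℝ] F, ∀ v : F,
        w (modelDeriv 𝓘(ℝ, F) 𝓘(ℝ, F) e (proj H 1) v) = v := by
      refine ⟨modelDeriv 𝓘(ℝ, F) 𝓘(ℝ, F) e.symm (e (proj H 1)), fun v ↦ ?_⟩
      exact DFunLike.congr_fun ((mdifferentiable_of_mem_maximalAtlas he).symm_comp_deriv ho) v
    refine (w.contDiff.comp_contDiffOn (h2.sub h1).snd).congr fun v hv ↦ ?_
    have h3 : frameDeriv H ((1 : G), v) (frameField b 0 ((1 : G), v)) - fieldVec W (frameMap H (1, v)) =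
        frameDeriv H ((1 : G), v) ((0 : E), ζ v) := by
      rw [hζ v hv, ← map_sub, frameField]
      simp
    change ζ v = w (compDeriv e (frameMap H ((1 : G), v)) (frameDeriv H ((1 : G), v)
      (frameField b 0 ((1 : G), v))) -
      compDeriv e (frameMap H (1, v)) (fieldVec W (frameMap H (1, v)))).2
    rw [← map_sub, h3, compDeriv_frameDeriv_vertical hπ he (q := (1, v)) ho, hw, baseDeriv_one]
  · simp [hζdef]
  · intro r hr v hv
    have hrv : r • v ≠ 0 := smul_ne_zero hr.ne' hv
    have hA : frameCoord H e (1, v) ≠ 0 := by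
      rw [frameCoord_eq, baseDeriv_one]
      intro h0
      exact hv ((mdifferentiable_of_mem_maximalAtlas he).mfderiv_injective ho
        (h0.trans (map_zero (modelDeriv 𝓘(ℝ, F) 𝓘(ℝ, F) e (proj H 1))).symm))
    have hAr := frameCoord_smul e (1 : G) r v
    have h1 := stdComponents_frameDeriv_smul hπ he (q := (1, v)) ho r (leftDeriv (1 : G) (b v))
      (-ζ v)
    have h2 := congrArg Prod.snd (hcomp v hv)
    have h3 := congrArg Prod.snd (hcomp _ hrv)
    rw [hAr, hCh _ (e.map_source ho) _ hA r hr, hζ _ hrv] at h3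
    rw [hζ v hv] at h2
    -- The `x`-components agree because the first entries do; the `y`-components agree because the
    -- spray coefficients and `frameDeriv` both scale by `r ^ 2`.
    have h4 : frameDeriv H (1, r • v) (leftDeriv (1 : G) (b (r • v)), -ζ (r • v)) =
        frameDeriv H (1, r • v) (leftDeriv (1 : G) (b (r • v)), r ^ 2 • (-ζ v)) := by
      refine compDeriv_injective he (p := frameMap H (1, r • v)) ho (Prod.ext ?_ ?_)
      · rw [compDeriv_frameDeriv_fst hπ he (q := (1, r • v)) ho,
          compDeriv_frameDeriv_fst hπ he (q := (1, r • v)) ho]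
      · rw [h3, map_smul b, map_smul]
        refine Eq.trans ?_ h1.symm
        refine Eq.trans ?_ (congrArg (r ^ 2 • ·) h2.symm)
        simp only [smul_neg]
        rw [smul_comm]
    have h5 := frameDeriv_injective_right hπ h4
    rwa [smul_neg, neg_inj] at h5
  -- The pairs `(h, v)` and `(1, h_* v)` represent the same tangent vector; relatedness at both is
  -- compared.
  · intro h hh v hv
    have hρ : baseDeriv H h v ≠ 0 := fun h0 ↦ hv (baseDeriv_injective hπ h (h0.trans (map_zero _).symm))
    have h1 := hrel (h, v) hv
    have h2 := frameMap_mul hπ hh 1 v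
    rw [one_mul] at h2
    rw [h2, hζ _ hρ, frameField, ← frameDeriv_right hπ hh (h, v), mul_inv_cancel, hb.equivariant h hh] at h1
    have h3 := frameDeriv_injective_right hπ h1
    rwa [map_neg, neg_inj] at h3

theorem exists_frameMap_eq (hπ : Manifold.IsSubmersion 𝓘(ℝ, E) 𝓘(ℝ, F) ∞ (proj H))
    (p : TangentBundle 𝓘(ℝ, F) (G ⧸ H)) : ∃ q : G × F, frameMap H q = p := by
  obtain ⟨g, hg⟩ := QuotientGroup.mk_surjective p.1
  exact ⟨_, frameMap_frameVec hπ g p hg⟩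

/-- Related fields coincide. -/
theorem IsRelatedField.eq (hπ : Manifold.IsSubmersion 𝓘(ℝ, E) 𝓘(ℝ, F) ∞ (proj H))
    {b : F →L[ℝ] E} {ζ : F → F} {W W' : TangentBundleField F (G ⧸ H)}
    (h : IsRelatedField b ζ W) (h' : IsRelatedField b ζ W')
    (hW : ∀ p, p ∉ slit F (G ⧸ H) → W p = 0) (hW' : ∀ p, p ∉ slit F (G ⧸ H) → W' p = 0) :
    W = W' := by
  funext p
  by_cases hp : p ∈ slit F (G ⧸ H)
  · obtain ⟨q, rfl⟩ := exists_frameMap_eq hπ p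
    have hq := (frameMap_mem_slit hπ).1 hp
    exact (h q hq).trans (h' q hq).symm
  · rw [hW p hp, hW' p hp]

open Classical in
/-- The field on the tangent bundle of `G/H` induced by `frameField b ζ`. -/
def inducedField (H : Subgroup G) [ChartedSpace F (G ⧸ H)] [IsManifold 𝓘(ℝ, F) ∞ (G ⧸ H)]
    (b : F →L[ℝ] E) (ζ : F → F) : TangentBundleField F (G ⧸ H) := fun p ↦
  show F × F from if p ∈ slit F (G ⧸ H) then
    frameDeriv H (Quotient.out p.1, frameVec (Quotient.out p.1) p)
      (frameField b ζ (Quotient.out p.1, frameVec (Quotient.out p.1) p))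
  else 0

theorem inducedField_zero_off (b : F →L[ℝ] E) (ζ : F → F)
    (p : TangentBundle 𝓘(ℝ, F) (G ⧸ H)) (hp : p ∉ slit F (G ⧸ H)) :
    inducedField H b ζ p = 0 := if_neg hp

/-- The chosen representative differs from `g` by some `h⁻¹` with `h ∈ H`. Equivariance of `b` and
`ζ` makes `frameField b ζ` invariant under the `H`-action, so the choice does not matter. -/
theorem isRelatedField_inducedField (hπ : Manifold.IsSubmersion 𝓘(ℝ, E) 𝓘(ℝ, F) ∞ (proj H))
    {b : F →L[ℝ] E} (hb : IsHorizontalSection H b) {ζ : F → F}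
    (hζ : ∀ h ∈ H, ∀ v : F, v ≠ 0 → ζ (baseDeriv H h v) = baseDeriv H h (ζ v)) :
    IsRelatedField b ζ (inducedField H b ζ) := by
  rintro ⟨g, v⟩ hv
  refine (if_pos ((frameMap_mem_slit hπ).2 hv)).trans ?_
  obtain ⟨k, hk⟩ : ∃ k : G, k = Quotient.out (frameMap H (g, v)).1 := ⟨_, rfl⟩
  rw [← hk]
  have hkg : proj H k = proj H g := by rw [hk]; exact Quotient.out_eq' _
  obtain ⟨h, hh, rfl⟩ : ∃ h ∈ H, k = g * h⁻¹ :=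
    ⟨k⁻¹ * g, QuotientGroup.eq.1 hkg, by group⟩
  have h1 : frameVec (g * h⁻¹) (frameMap H (g, v)) = baseDeriv H h v := by
    have h2 := frameMap_mul hπ hh (g * h⁻¹) v
    rw [inv_mul_cancel_right] at h2
    rw [h2]
    exact frameVec_frameMap hπ (g * h⁻¹, baseDeriv H h v)
  rw [h1, frameField, hζ h hh v hv, hb.equivariant h hh, ← map_neg]
  exact frameDeriv_right hπ hh (g, v) (b v) (-ζ v)

theorem IsRelatedField.isInvariantField (hπ : Manifold.IsSubmersion 𝓘(ℝ, E) 𝓘(ℝ, F) ∞ (proj H))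
    {b : F →L[ℝ] E} {ζ : F → F} {W : TangentBundleField F (G ⧸ H)} (hW : IsRelatedField b ζ W) :
    IsInvariantField G W := by
  intro g p hp
  obtain ⟨q, rfl⟩ := exists_frameMap_eq hπ p
  have hq := (frameMap_mem_slit hπ).1 hp
  have h1 := hW (g * q.1, q.2) hq
  rw [← push_frameMap hπ] at h1
  have h2 := frameDeriv_left hπ g q (b q.2) (-ζ q.2)
  have h3 : modelDeriv 𝓘(ℝ, F).tangent 𝓘(ℝ, F).tangent (push g) (frameMap H q)
      (fieldVec W (frameMap H q)) = fieldVec W (push g (frameMap H q)) := by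
    rw [hW q hq, h1]; exact h2
  exact h3

/-- Near each point, a smooth local section `s` of `frameMap` writes `W` as the differential of
`frameMap` applied to `frameField b ζ` along `s`. -/
theorem IsRelatedField.isSlitField (hπ : Manifold.IsSubmersion 𝓘(ℝ, E) 𝓘(ℝ, F) ∞ (proj H))
    {b : F →L[ℝ] E} {ζ : F → F} (hζ : ContDiffOn ℝ ∞ ζ {0}ᶜ) {W : TangentBundleField F (G ⧸ H)}
    (hW : IsRelatedField b ζ W) (hW0 : ∀ p, p ∉ slit F (G ⧸ H) → W p = 0) : IsSlitField W := by
  refine ⟨fun p hp ↦ ?_, hW0⟩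
  obtain ⟨U, hU, s, hs, hsU⟩ := exists_section_frameMap hπ p
  have h1 := ((contMDiff_frameMap hπ).contMDiff_tangentMap (m := ∞) (by simp)).comp_contMDiffOn
    (contMDiffOn_frameField (G := G) b hζ)
  have hmem : ∀ z ∈ slit F (G ⧸ H) ∩ U, (s z).2 ≠ 0 := fun z hz ↦ by
    rw [← frameMap_mem_slit hπ, hsU z hz.2]; exact hz.1
  have h2 := h1.comp (hs.mono inter_subset_right) hmem
  have h3 : ContMDiffOn 𝓘(ℝ, F).tangent 𝓘(ℝ, F).tangent.tangent ∞
    (fun p ↦ (⟨p, W p⟩ : TangentBundle 𝓘(ℝ, F).tangent (TangentBundle 𝓘(ℝ, F) (G ⧸ H))))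
      (slit F (G ⧸ H) ∩ U) := by
    refine h2.congr fun z hz ↦ ?_
    have h4 := hW (s z) (hmem z hz)
    have h5 := hsU z hz.2
    -- `W` at `frameMap H (s z)` and `W` at `z` have different types, so the equality is transported
    -- in the total space.
    have h6 : ∀ z' : TangentBundle 𝓘(ℝ, F) (G ⧸ H), z' = z →
      (⟨z, W z⟩ : TangentBundle 𝓘(ℝ, F).tangent (TangentBundle 𝓘(ℝ, F) (G ⧸ H))) =
        ⟨z', W z'⟩ := by rintro _ rfl; rfl
    rw [h6 _ h5]
    exact congrArg (Bundle.TotalSpace.mk (frameMap H (s z))) h4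
  exact (h3 p ⟨hp, mem_of_mem_nhds hU⟩).mono_of_mem_nhdsWithin
    (inter_mem_nhdsWithin _ hU)

theorem IsRelatedField.isSpray (hπ : Manifold.IsSubmersion 𝓘(ℝ, E) 𝓘(ℝ, F) ∞ (proj H))
    {b : F →L[ℝ] E} (hb : IsHorizontalSection H b)
    {ζ : F → F} (hζ : IsIsotropyInvariant H ζ) {W : TangentBundleField F (G ⧸ H)}
    (hW : IsRelatedField b ζ W) (hW0 : ∀ p, p ∉ slit F (G ⧸ H) → W p = 0) : IsSpray W := by
  refine ⟨hW.isSlitField hπ hζ.smooth hW0, fun e he ↦ ?_⟩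
  -- The coefficients are forced: `-1/2` times the `y`-component of `W` at the point with
  -- coordinates `(x, y)`.
  refine ⟨fun x y ↦ -((2 : ℝ)⁻¹ • (compDeriv e (stdCoordSymm e (x, y))
    (fieldVec W (stdCoordSymm e (x, y)))).2), ?_, ?_⟩
  · intro p hp hpe
    obtain ⟨q, rfl⟩ := exists_frameMap_eq hπ p
    have hq := (frameMap_mem_slit hπ).1 hp
    beta_reduce
    rw [Prod.mk.eta, stdCoordSymm_stdCoord he hpe]
    refine Prod.ext ?_ ?_
    · change (compDeriv e (frameMap H q) (fieldVec W (frameMap H q))).1 = _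
      rw [hW q hq]
      exact compDeriv_frameDeriv_horizontal_fst hb hπ he hpe _
    · simp only [smul_neg, neg_neg]
      rw [smul_smul, mul_inv_cancel₀ two_ne_zero, one_smul]
      rfl
  · intro x hx y hy r hr
    obtain ⟨q, hq⟩ := exists_frameMap_eq hπ (stdCoordSymm e (x, y))
    have hqx : proj H q.1 = e.symm x := congrArg (fun p : TangentBundle 𝓘(ℝ, F) (G ⧸ H) ↦ p.1) hq
    have hqy : baseDeriv H q.1 q.2 = modelDeriv 𝓘(ℝ, F) 𝓘(ℝ, F) e.symm x y :=
      congrArg fiberVec hq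
    have hqr : frameMap H (q.1, r • q.2) = stdCoordSymm e (x, r • y) := by
      refine tangentBundle_ext hqx ?_
      change baseDeriv H q.1 (r • q.2) = modelDeriv 𝓘(ℝ, F) 𝓘(ℝ, F) e.symm x (r • y)
      rw [map_smul, map_smul, hqy]
    have hqe : proj H q.1 ∈ e.source := by rw [hqx]; exact e.map_target hx
    have hq0 : q.2 ≠ 0 := by
      intro h0
      refine hy ((mdifferentiable_of_mem_maximalAtlas he).symm.mfderiv_injective hx ?_)
      rw [h0, map_zero] at hqy
      exact hqy.symm.trans (map_zero (modelDeriv 𝓘(ℝ, F) 𝓘(ℝ, F) e.symm x)).symm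
    have h1 := stdComponents_frameDeriv_smul hπ he hqe r (leftDeriv q.1 (b q.2)) (-ζ q.2)
    have h2 : frameField b ζ (q.1, r • q.2) =
        (r • leftDeriv q.1 (b q.2), r ^ 2 • (-ζ q.2)) := by
      simp only [frameField, map_smul, hζ.homogeneous r hr _ hq0, smul_neg]
    beta_reduce
    rw [← hq, ← hqr, hW q hq0, hW (q.1, r • q.2) (smul_ne_zero hr.ne' hq0), h2]
    rw [smul_neg (r ^ 2) ((2 : ℝ)⁻¹ • _), smul_comm (r ^ 2) (2 : ℝ)⁻¹]
    exact congrArg (fun z ↦ -((2 : ℝ)⁻¹ • z)) h1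

/-! ### Geodesics and their horizontal lifts -/

theorem leftDeriv_modelDeriv_mul_left_inv (k : G) (ξ : E) :
    leftDeriv k (modelDeriv 𝓘(ℝ, E) 𝓘(ℝ, E) (fun x : G ↦ k⁻¹ * x) k ξ) = ξ := by
  have h1 := (hasModelDerivAt_mul_left (E := E) k 1).comp_of_eq
    (hasModelDerivAt_mul_left (E := E) k⁻¹ k) (inv_mul_cancel k)
  simp only [mul_inv_cancel_left] at h1
  exact DFunLike.congr_fun (h1.unique (hasModelDerivAt_id (I := 𝓘(ℝ, E)) k)) ξ

theorem leftVelocity_eq {γ : ℝ → G} {t : ℝ} {ξ : E} {L : ℝ →L[ℝ] E}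
    (hγ : HasModelDerivAt 𝓘(ℝ, ℝ) 𝓘(ℝ, E) γ t L) (hL : L 1 = leftDeriv (γ t) ξ) :
    leftVelocity γ t = ξ := by
  change modelDeriv 𝓘(ℝ, E) 𝓘(ℝ, E) (fun x : G ↦ (γ t)⁻¹ * x) (γ t)
    (modelDeriv 𝓘(ℝ, ℝ) 𝓘(ℝ, E) γ t (1 : ℝ)) = ξ
  rw [hγ.modelDeriv, hL, modelDeriv_mul_left_leftDeriv, inv_mul_cancel, leftDeriv_one]

/-- The left translated velocity of a smooth curve is smooth. -/
theorem contDiffOn_leftVelocity {γ : ℝ → G} {s : Set ℝ} (hs : IsOpen s)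
    (hγ : ContMDiffOn 𝓘(ℝ, ℝ) 𝓘(ℝ, E) ∞ γ s) :
    ContDiffOn ℝ ∞ (fun t ↦ (leftVelocity γ t : E)) s := by
  have h1 := (hγ.contMDiffOn_tangentMapWithin (m := ∞) (by simp) hs.uniqueMDiffOn).comp
    ((contMDiff_tangentBundle_mk (F := ℝ)).comp
      (contDiff_id.prodMk contDiff_const : ContDiff ℝ ∞ (fun t : ℝ ↦ (t, (1 : ℝ)))).contMDiff).contMDiffOn
    (s := s) (fun t ht ↦ ht)
  have h2 := (contMDiff_tangentMap_param (contMDiff_mul 𝓘(ℝ, E) ∞ (G := G))).comp_contMDiffOn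
    (hγ.inv.prodMk h1)
  refine (contMDiffOn_of_fiberMk (1 : G) (h2.congr fun t ht ↦ ?_)).contDiffOn
  refine tangentBundle_ext (inv_mul_cancel (γ t)).symm ?_
  change modelDeriv 𝓘(ℝ, E) 𝓘(ℝ, E) (fun x : G ↦ (γ t)⁻¹ * x) (γ t)
    (mfderiv 𝓘(ℝ, ℝ) 𝓘(ℝ, E) γ t (1 : ℝ)) =
    modelDeriv 𝓘(ℝ, E) 𝓘(ℝ, E) (fun x : G ↦ (γ t)⁻¹ * x) (γ t)
    (mfderivWithin 𝓘(ℝ, ℝ) 𝓘(ℝ, E) γ s t (1 : ℝ))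
  rw [mfderivWithin_of_isOpen hs ht]

theorem velocity_eq_frameMap (hπ : Manifold.IsSubmersion 𝓘(ℝ, E) 𝓘(ℝ, F) ∞ (proj H))
    {c : ℝ → G ⧸ H} {γ : ℝ → G} {t : ℝ} {L : ℝ →L[ℝ] E} (hc : ∀ᶠ τ in 𝓝 t, proj H (γ τ) = c τ)
    (hγ : HasModelDerivAt 𝓘(ℝ, ℝ) 𝓘(ℝ, E) γ t L) {ξ : E} (hL : L 1 = leftDeriv (γ t) ξ) :
    velocity (F := F) c t = frameMap H (γ t, projDeriv E H ξ) := by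
  refine tangentBundle_ext hc.self_of_nhds.symm ?_
  change modelDeriv 𝓘(ℝ, ℝ) 𝓘(ℝ, F) c t (1 : ℝ) = baseDeriv H (γ t) (projDeriv E H ξ)
  have h1 := ((hasModelDerivAt_proj hπ (γ t)).comp hγ).congr (f₁ := c)
    (hc.mono fun τ hτ ↦ hτ.symm)
  rw [h1.modelDeriv, ContinuousLinearMap.comp_apply, hL, modelDeriv_proj_leftDeriv hπ]

theorem hasModelDerivAt_of_isMIntegralCurveOn {E' H' M : Type*} [NormedAddCommGroup E']
    [NormedSpace ℝ E'] [TopologicalSpace H'] {I : ModelWithCorners ℝ E' H'} [TopologicalSpace M]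
    [ChartedSpace H' M] {v : ∀ x : M, TangentSpace I x} {γ : ℝ → M} {s : Set ℝ} (hs : IsOpen s)
    (hγ : IsMIntegralCurveOn γ v s) {t : ℝ} (ht : t ∈ s) :
    HasModelDerivAt 𝓘(ℝ, ℝ) I γ t
      (ContinuousLinearMap.toSpanSingleton ℝ (show E' from v (γ t))) := by
  have h := (hγ t ht).hasMFDerivAt (hs.mem_nhds ht)
  have h1 : ∀ w : E', (1 : ℝ →L[ℝ] ℝ).smulRight w =
    ContinuousLinearMap.toSpanSingleton ℝ w := fun w ↦ by ext; simp
  rw [← h1]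
  exact h

/-- Geodesics of a related field, together with horizontal lifts, are projections of integral
curves. -/
theorem exists_isGeodesicLift [CompleteSpace E] [CompleteSpace F]
    (hπ : Manifold.IsSubmersion 𝓘(ℝ, E) 𝓘(ℝ, F) ∞ (proj H))
    {𝔪 : Submodule ℝ (GroupLieAlgebra 𝓘(ℝ, E) G)} {b : F →L[ℝ] E} (hb : IsHorizontalSection H b)
    (hb𝔪 : ∀ v, (b v : E) ∈ 𝔪)
    {ζ : F → F} (hζ : ContDiffOn ℝ ∞ ζ {0}ᶜ) {W : TangentBundleField F (G ⧸ H)}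
    (hW : IsRelatedField b ζ W) (y : 𝔪) (hy : projDeriv (F := F) E H y.1 ≠ 0) :
    ∃ c γ, IsGeodesicLift 𝔪 W y c γ := by
  set v₀ : F := projDeriv E H y.1
  have hX := contMDiffOn_frameField (G := G) b hζ
  have hO : IsOpen {q : G × F | q.2 ∈ ({0}ᶜ : Set F)} := isOpen_compl_singleton.preimage continuous_snd
  -- The `G`-component of this integral curve is the lift, and its projection to `G/H` is the
  -- geodesic.
  obtain ⟨σ, hσ0, hσ⟩ := exists_isMIntegralCurveAt_of_contMDiffAt_boundaryless (t₀ := 0)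
    (I := 𝓘(ℝ, E).prod 𝓘(ℝ, F)) (x₀ := ((1 : G), v₀)) (v := frameField b ζ)
    ((hX.contMDiffAt (hO.mem_nhds hy)).of_le (by exact_mod_cast le_top))
  have h1 : ∀ᶠ t in 𝓝 (0 : ℝ), (σ t).2 ≠ 0 :=
    hσ.continuousAt.eventually (hO.mem_nhds (by rw [hσ0]; exact hy))
  obtain ⟨ε₁, hε₁, hσ₁⟩ := isMIntegralCurveAt_iff'.1 hσ
  obtain ⟨ε₂, hε₂, hσ₂⟩ := Metric.eventually_nhds_iff_ball.1 h1
  obtain ⟨ε, hε, hεσ, hε2⟩ : ∃ ε > 0, IsMIntegralCurveOn σ (frameField b ζ) (Ioo (-ε) ε) ∧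
      ∀ t ∈ Ioo (-ε) ε, (σ t).2 ≠ 0 := by
    refine ⟨min ε₁ ε₂, lt_min hε₁ hε₂, hσ₁.mono ?_, fun t ht ↦ hσ₂ t ?_⟩
    · rw [Real.ball_eq_Ioo]
      exact Ioo_subset_Ioo (by simp) (by simp)
    · rw [Real.ball_eq_Ioo]
      exact Ioo_subset_Ioo (by simp) (by simp) ht
  have hsm : ContMDiffOn 𝓘(ℝ, ℝ) (𝓘(ℝ, E).prod 𝓘(ℝ, F)) ∞ σ (Ioo (-ε) ε) :=
    contMDiffOn_of_isMIntegralCurveOn hX isOpen_Ioo hε2 hεσ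
  have hγs : ContMDiffOn 𝓘(ℝ, ℝ) 𝓘(ℝ, E) ∞ (fun t ↦ (σ t).1) (Ioo (-ε) ε) :=
    contMDiff_fst.comp_contMDiffOn hsm
  have hd : ∀ t ∈ Ioo (-ε) ε, HasModelDerivAt 𝓘(ℝ, ℝ) (𝓘(ℝ, E).prod 𝓘(ℝ, F)) σ t
      (ContinuousLinearMap.toSpanSingleton ℝ (frameField b ζ (σ t))) :=
    fun t ht ↦ hasModelDerivAt_of_isMIntegralCurveOn isOpen_Ioo hεσ ht
  have hγd : ∀ t ∈ Ioo (-ε) ε, HasModelDerivAt 𝓘(ℝ, ℝ) 𝓘(ℝ, E) (fun t ↦ (σ t).1) t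
      ((ContinuousLinearMap.fst ℝ E F).comp
        (ContinuousLinearMap.toSpanSingleton ℝ (frameField b ζ (σ t)))) := fun t ht ↦
    (show HasModelDerivAt (𝓘(ℝ, E).prod 𝓘(ℝ, F)) 𝓘(ℝ, E) (fun z : G × F ↦ z.1) (σ t)
      (ContinuousLinearMap.fst ℝ E F) from hasMFDerivAt_fst (σ t)).comp (hd t ht)
  have hL : ∀ t, ((ContinuousLinearMap.fst ℝ E F).comp
      (ContinuousLinearMap.toSpanSingleton ℝ (frameField b ζ (σ t)))) 1 =
      leftDeriv (σ t).1 (b (σ t).2) := fun t ↦ by simp [frameField]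
  have hvel : ∀ t ∈ Ioo (-ε) ε, velocity (F := F) (fun t ↦ proj H (σ t).1) t = frameMap H (σ t) := by
    intro t ht
    rw [velocity_eq_frameMap hπ (Eventually.of_forall fun τ ↦ rfl) (hγd t ht) (hL t),
      hb.right_inv]
  have h0 : (0 : ℝ) ∈ Ioo (-ε) ε := ⟨by linarith, hε⟩
  refine ⟨fun t ↦ proj H (σ t).1, fun t ↦ (σ t).1, ?_, by rw [hσ0], ε, hε, ⟨?_, ?_, ?_⟩, hγs, ?_⟩
  · rw [hvel 0 h0, hσ0, frameMap_one]
    rfl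
  · exact hπ.contMDiff.comp_contMDiffOn hγs
  · intro t ht
    rw [hvel t ht, frameMap_mem_slit hπ]
    exact hε2 t ht
  · intro t ht
    have h2 := ((hasModelDerivAt_frameMap hπ (σ t)).comp (hd t ht)).congr
      (f₁ := velocity (F := F) (fun t ↦ proj H (σ t).1)) (by
        filter_upwards [isOpen_Ioo.mem_nhds ht] with τ hτ using hvel τ hτ)
    have h3 : (frameDeriv H (σ t)).comp
        (ContinuousLinearMap.toSpanSingleton ℝ (frameField b ζ (σ t))) =
        (1 : ℝ →L[ℝ] ℝ).smulRight
          (fieldVec W (velocity (F := F) (fun t ↦ proj H (σ t).1) t)) := by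
      ext1
      rw [hvel t ht, hW _ (hε2 t ht)]
      simp
    rw [h3] at h2
    exact HasMFDerivAt.hasMFDerivWithinAt h2
  · intro t ht
    have h2 : leftVelocity (E := E) (fun t ↦ (σ t).1) t = b (σ t).2 :=
      leftVelocity_eq (hγd t ht) (hL t)
    rw [h2]
    refine ⟨rfl, hb𝔪 _, fun h3 ↦ hε2 t ht ?_⟩
    rw [← hb.right_inv (σ t).2]
    exact (congrArg (projDeriv E H) h3).trans (map_zero _)

/-- With `u` the left velocity, the velocity of `c` is `frameMap (γ, π_* u)`. Differentiating at `0`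
and comparing with `W`, the first entries agree because `u` lies in `𝔪`; hence the second ones do,
giving `π_* u' = -ζ(π_* u)`. Applying `b` recovers `u'`. -/
theorem hasDerivAt_leftVelocity (hπ : Manifold.IsSubmersion 𝓘(ℝ, E) 𝓘(ℝ, F) ∞ (proj H))
    {𝔪 : Submodule ℝ (GroupLieAlgebra 𝓘(ℝ, E) G)} {b : F →L[ℝ] E}
    (hb𝔪' : ∀ ξ : E, ξ ∈ 𝔪 → b (projDeriv E H ξ) = ξ)
    {ζ : F → F} {W : TangentBundleField F (G ⧸ H)}
    (hW : IsRelatedField b ζ W) {y : 𝔪} (hy : projDeriv (F := F) E H y.1 ≠ 0)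
    {c : ℝ → G ⧸ H} {γ : ℝ → G} (h : IsGeodesicLift 𝔪 W y c γ) :
    HasDerivAt (fun t ↦ (leftVelocity γ t : E)) (-b (ζ (projDeriv E H y.1))) 0 := by
  obtain ⟨ε, hε, hg, hγ, hl⟩ := h.lift
  have h0 : (0 : ℝ) ∈ Ioo (-ε) ε := ⟨by linarith, hε⟩
  have hn : Ioo (-ε) ε ∈ 𝓝 (0 : ℝ) := isOpen_Ioo.mem_nhds h0
  set u : ℝ → E := fun t ↦ leftVelocity γ t with hu
  have hγd : ∀ t ∈ Ioo (-ε) ε, HasModelDerivAt 𝓘(ℝ, ℝ) 𝓘(ℝ, E) γ t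
      (modelDeriv 𝓘(ℝ, ℝ) 𝓘(ℝ, E) γ t) := fun t ht ↦
    (hγ.contMDiffAt (isOpen_Ioo.mem_nhds ht)).hasModelDerivAt
  have hγu : ∀ t, modelDeriv 𝓘(ℝ, ℝ) 𝓘(ℝ, E) γ t 1 = leftDeriv (γ t) (u t) :=
    fun t ↦ (leftDeriv_modelDeriv_mul_left_inv (γ t) _).symm
  have hvel : ∀ t ∈ Ioo (-ε) ε, velocity (F := F) c t = frameMap H (γ t, projDeriv E H (u t)) := by
    intro t ht
    refine velocity_eq_frameMap hπ ?_ (hγd t ht) (hγu t)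
    filter_upwards [isOpen_Ioo.mem_nhds ht] with τ hτ using (hl τ hτ).1
  have hv0 : projDeriv (F := F) E H (u 0) = projDeriv (F := F) E H y.1 := by
    have h1 := (hvel 0 h0).symm.trans h.velocity_zero
    rw [h.lift_zero, frameMap_one] at h1
    exact congrArg fiberVec h1
  have hu𝔪 : ∀ t ∈ Ioo (-ε) ε, b (projDeriv (F := F) E H (u t)) = u t :=
    fun t ht ↦ hb𝔪' _ (hl t ht).2.1
  have hud : HasDerivAt u (deriv u 0) 0 :=
    (((contDiffOn_leftVelocity isOpen_Ioo hγ).contDiffAt hn).differentiableAt (by simp)).hasDerivAt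
  -- The relation `b (π_* u) = u` holds on a neighbourhood of `0`, so it passes to the derivative.
  have hud' : b (projDeriv E H (deriv u 0)) = deriv u 0 := by
    have h1 := (b.comp (projDeriv E H)).hasFDerivAt.comp_hasDerivAt (0 : ℝ) hud
    refine (h1.congr_of_eventuallyEq ?_).unique hud
    filter_upwards [hn] with t ht using (hu𝔪 t ht).symm
  have h1 : HasModelDerivAt 𝓘(ℝ, ℝ) 𝓘(ℝ, F).tangent (velocity (F := F) c) 0
      (ContinuousLinearMap.toSpanSingleton ℝ (fieldVec W (velocity (F := F) c 0))) :=
    hasModelDerivAt_of_isMIntegralCurveOn isOpen_Ioo hg.integral h0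
  have h2 := ((hasModelDerivAt_frameMap hπ (γ 0, projDeriv E H (u 0))).comp_of_eq
    ((hγd 0 h0).prodMk ((projDeriv E H).hasFDerivAt.comp_hasDerivAt (0 : ℝ)
      hud).hasFDerivAt.hasModelDerivAt) rfl).congr (f₁ := velocity (F := F) c) (by
        filter_upwards [hn] with t ht using hvel t ht)
  have h3 := DFunLike.congr_fun (h1.unique h2) 1
  rw [hvel 0 h0, hW _ (by rw [hv0]; exact hy)] at h3
  have h4 : frameDeriv H (γ 0, projDeriv E H (u 0)) (leftDeriv (γ 0) (u 0),
      -ζ (projDeriv E H (u 0))) = frameDeriv H (γ 0, projDeriv E H (u 0)) (leftDeriv (γ 0) (u 0),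
        projDeriv E H (deriv u 0)) := by
    have h5 : frameField b ζ (γ 0, projDeriv E H (u 0)) = (leftDeriv (γ 0) (u 0),
      -ζ (projDeriv E H (u 0))) := by rw [frameField, hu𝔪 0 h0]
    rw [← h5, ← hγu 0]
    simpa using h3
  have h5 := frameDeriv_injective_right hπ h4
  rw [hv0] at h5
  rw [← map_neg, h5, hud']
  exact hud

end Homogeneous

/-! ### Derivatives of sums and products; uniqueness of the geodesic spray -/

section Linear

variable {E E' H M : Type*} [NormedAddCommGroup E] [NormedSpace ℝ E]
  [NormedAddCommGroup E'] [NormedSpace ℝ E'] [TopologicalSpace H] {I : ModelWithCorners ℝ E H}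
  [TopologicalSpace M] [ChartedSpace H M]

theorem HasModelDerivAt.add {f g : M → E'} {x : M} {A B : E →L[ℝ] E'}
    (hf : HasModelDerivAt I 𝓘(ℝ, E') f x A) (hg : HasModelDerivAt I 𝓘(ℝ, E') g x B) :
    HasModelDerivAt I 𝓘(ℝ, E') (fun z ↦ f z + g z) x (A + B) :=
  HasMFDerivAt.add hf hg

theorem HasModelDerivAt.smul {f : M → ℝ} {g : M → E'} {x : M} {A : E →L[ℝ] ℝ} {B : E →L[ℝ] E'}
    (hf : HasModelDerivAt I 𝓘(ℝ, ℝ) f x A) (hg : HasModelDerivAt I 𝓘(ℝ, E') g x B) :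
    HasModelDerivAt I 𝓘(ℝ, E') (fun z ↦ f z • g z) x (f x • B + A.smulRight (g x)) := by
  constructor
  · exact hf.1.smul hg.1
  · simpa using! hf.2.smul hg.2

end Linear

section Sections

variable {F M : Type*} [NormedAddCommGroup F] [NormedSpace ℝ F]
  [TopologicalSpace M] [ChartedSpace F M] [IsManifold 𝓘(ℝ, F) ∞ M]

theorem mdifferentiableAt_of_fiberMk {E' H' N : Type*} [NormedAddCommGroup E']
    [NormedSpace ℝ E'] [TopologicalSpace H'] {J : ModelWithCorners ℝ E' H'} [TopologicalSpace N]
    [ChartedSpace H' N] (x : M) {f : N → F} {z : N}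
    (hf : MDifferentiableAt J 𝓘(ℝ, F).tangent (fun z ↦ fiberMk x (f z)) z) :
    MDifferentiableAt J 𝓘(ℝ, F) f z := by
  have h1 : ∀ v : F, (trivializationAt F (TangentSpace 𝓘(ℝ, F)) x (fiberMk x v)).2 = v :=
    fun v ↦ (tangentBundleCore 𝓘(ℝ, F) M).coordChange_self _ _ (mem_chart_source F x) v
  exact ((mdifferentiableAt_totalSpace _ _).1 hf).2.congr_of_eventuallyEq
    (Eventually.of_forall fun y ↦ (h1 (f y)).symm)

/-- A vector field, as a map into the tangent bundle. -/
def sectionMap (Y : ∀ x : M, TangentSpace 𝓘(ℝ, F) x) (x : M) : TangentBundle 𝓘(ℝ, F) M := ⟨x, Y x⟩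

/-- Geodesic sprays of affine connections are determined by the connection. -/
theorem IsGeodesicSprayOf.eq
    {D : CovariantDerivative 𝓘(ℝ, F) F (TangentSpace 𝓘(ℝ, F) : M → Type _)}
    {W W' : TangentBundleField F M} (h : IsGeodesicSprayOf D W) (h' : IsGeodesicSprayOf D W')
    (hW : ∀ p, p ∉ slit F M → W p = 0) (hW' : ∀ p, p ∉ slit F M → W' p = 0) : W = W' := by
  funext p
  by_cases hp : p ∈ slit F M
  · have h1 := FiberBundle.mdifferentiableAt_extend 𝓘(ℝ, F) F p.2
    have h2 := FiberBundle.extend_apply_self F p.2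
    have h3 : FiberBundle.extend F p.2 p.1 ≠ 0 := by rw [h2]; exact hp
    have h4 := (h _ p.1 h1 h3).trans (h' _ p.1 h1 h3).symm
    rw [h2] at h4
    exact h4
  · rw [hW p hp, hW' p hp]

end Sections

/-! ### The Nomizu connection and its geodesic spray -/

section Homogeneous

variable {E F G : Type*} [NormedAddCommGroup E] [NormedSpace ℝ E]
  [NormedAddCommGroup F] [NormedSpace ℝ F]
  [TopologicalSpace G] [ChartedSpace E G] [Group G] [LieGroup 𝓘(ℝ, E) ∞ G]
  {H : Subgroup G} [ChartedSpace F (G ⧸ H)] [IsManifold 𝓘(ℝ, F) ∞ (G ⧸ H)]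

theorem frameMap_framedField (hπ : Manifold.IsSubmersion 𝓘(ℝ, E) 𝓘(ℝ, F) ∞ (proj H))
    (Y : ∀ x : G ⧸ H, TangentSpace 𝓘(ℝ, F) x) (g : G) :
    frameMap H (g, framedField Y g) = sectionMap Y (proj H g) :=
  frameMap_frameVec hπ g (sectionMap Y (proj H g)) rfl

theorem baseDeriv_framedField (hπ : Manifold.IsSubmersion 𝓘(ℝ, E) 𝓘(ℝ, F) ∞ (proj H))
    (Y : ∀ x : G ⧸ H, TangentSpace 𝓘(ℝ, F) x) (g : G) :
    baseDeriv H g (framedField Y g) = Y (proj H g) :=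
  congrArg fiberVec (frameMap_framedField hπ Y g)

/-- The vector `(k⁻¹)_* Y(k · o)` stays over the base point, so differentiability as a map into the
tangent bundle gives differentiability of its fibre part. -/
theorem hasModelDerivAt_framedField (hπ : Manifold.IsSubmersion 𝓘(ℝ, E) 𝓘(ℝ, F) ∞ (proj H))
    {Y : ∀ x : G ⧸ H, TangentSpace 𝓘(ℝ, F) x} {g : G}
    (hY : MDifferentiableAt 𝓘(ℝ, F) 𝓘(ℝ, F).tangent
      (fun z ↦ (⟨z, Y z⟩ : TangentBundle 𝓘(ℝ, F) (G ⧸ H))) (proj H g)) :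
    HasModelDerivAt 𝓘(ℝ, E) 𝓘(ℝ, F) (framedField Y) g
      (modelDeriv 𝓘(ℝ, E) 𝓘(ℝ, F) (framedField Y) g) := by
  have h1 := hY.hasModelDerivAt.comp (hasModelDerivAt_proj hπ g)
  have h2 : HasModelDerivAt 𝓘(ℝ, E) 𝓘(ℝ, E) (fun k : G ↦ k⁻¹) g _ :=
    (contMDiff_inv 𝓘(ℝ, E) ∞ (G := G)).contMDiffAt.hasModelDerivAt
  have h3 := ((contMDiff_push hπ).contMDiffAt.hasModelDerivAt.comp_of_eq
    (h2.prodMk h1) rfl).mdifferentiableAt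
  refine (mdifferentiableAt_of_fiberMk (proj H 1)
    (h3.congr_of_eventuallyEq (Eventually.of_forall fun k ↦ ?_))).hasModelDerivAt
  refine tangentBundle_ext ?_ rfl
  change proj H 1 = k⁻¹ • proj H k
  rw [smul_proj, inv_mul_cancel]

/-- The geodesic spray of the Nomizu connection. -/
theorem IsNomizuConnection.isGeodesicSprayOf
    (hπ : Manifold.IsSubmersion 𝓘(ℝ, E) 𝓘(ℝ, F) ∞ (proj H))
    {b : F →L[ℝ] E} (hb : IsHorizontalSection H b)
    {𝔪 : Submodule ℝ (GroupLieAlgebra 𝓘(ℝ, E) G)} (hb𝔪 : ∀ v : F, b v ∈ 𝔪)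
    {D : CovariantDerivative 𝓘(ℝ, F) F (TangentSpace 𝓘(ℝ, F) : G ⧸ H → Type _)}
    (hD : IsNomizuConnection 𝔪 D) {W : TangentBundleField F (G ⧸ H)}
    (hW : IsRelatedField b 0 W) : IsGeodesicSprayOf D W := by
  intro Y x hY hY0
  obtain ⟨g, rfl⟩ := QuotientGroup.mk_surjective x
  obtain ⟨v, hv⟩ : ∃ v : F, v = framedField Y g := ⟨_, rfl⟩
  have hvY : baseDeriv H g v = Y (proj H g) := hv ▸ baseDeriv_framedField hπ Y g
  have hfr : frameMap H (g, v) = sectionMap Y (proj H g) :=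
    hv ▸ frameMap_framedField hπ Y g
  have hv0 : v ≠ 0 := by
    rintro rfl
    exact hY0 (hvY.symm.trans (map_zero _))
  obtain ⟨L, hL⟩ : ∃ L : E →L[ℝ] F, HasModelDerivAt 𝓘(ℝ, E) 𝓘(ℝ, F) (framedField Y) g L :=
    ⟨_, hasModelDerivAt_framedField hπ hY⟩
  have hproj : modelDeriv 𝓘(ℝ, E) 𝓘(ℝ, F) (proj H) g (leftDeriv g (b v)) = Y (proj H g) :=
    (hb.modelDeriv_proj hπ (g, v)).trans hvY
  -- `frameMap` along the graph of `framedField Y` is `Y ∘ π`; comparing the two chain rules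
  -- expresses the differential of `Y` through `L`.
  have h1 := (hasModelDerivAt_frameMap hπ (g, v)).comp_of_eq
    ((hasModelDerivAt_id (I := 𝓘(ℝ, E)) g).prodMk hL) (by rw [hv])
  simp only [frameMap_framedField hπ] at h1
  have h2 := DFunLike.congr_fun (h1.unique (hY.hasModelDerivAt.comp (hasModelDerivAt_proj hπ g)))
    (leftDeriv g (b v))
  have h3 : frameDeriv H (g, v) (leftDeriv g (b v), L (leftDeriv g (b v))) =
      modelDeriv 𝓘(ℝ, F) 𝓘(ℝ, F).tangent
        (fun z ↦ (⟨z, Y z⟩ : TangentBundle 𝓘(ℝ, F) (G ⧸ H))) (proj H g) (Y (proj H g)) := by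
    rw [← hproj]; exact h2
  have h4 : (show F from D Y (proj H g) (Y (proj H g))) =
      baseDeriv (F := F) H g (L (leftDeriv g (b v))) := by
    have h5 := hD Y g hY (b v) (hb𝔪 v)
    have h6 : modelDeriv 𝓘(ℝ, E) 𝓘(ℝ, F) (framedField Y) g (leftDeriv g (b v)) =
        L (leftDeriv g (b v)) := by rw [hL.modelDeriv]
    refine Eq.trans ?_ (h5.trans (congrArg (baseDeriv (F := F) H g) h6))
    exact congrArg (D Y (proj H g)) hproj.symm
  have h5 := hW (g, v) hv0
  have h6 := frameDeriv_vertical hπ (g, v) (L (leftDeriv g (b v)))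
  have h7 : fieldVec W (frameMap H (g, v)) =
      frameDeriv H (g, v) (leftDeriv g (b v), L (leftDeriv g (b v))) -
      frameDeriv H (g, v) ((0 : E), L (leftDeriv g (b v))) := by
    rw [h5, ← map_sub, frameField]
    simp
  rw [h3, h6, hfr, ← h4] at h7
  exact h7

/-- Both sides are components of the same vector `Y(g · o)` in the frame transported by `g h⁻¹`. -/
theorem framedField_mul (hπ : Manifold.IsSubmersion 𝓘(ℝ, E) 𝓘(ℝ, F) ∞ (proj H))
    (Y : ∀ x : G ⧸ H, TangentSpace 𝓘(ℝ, F) x) {h : G} (hh : h ∈ H) (g : G) :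
    framedField Y (g * h⁻¹) = baseDeriv H h (framedField Y g) := by
  have h1 : proj H (g * h⁻¹) = proj H g := QuotientGroup.mk_mul_of_mem g (H.inv_mem hh)
  have h2 : frameMap H (g * h⁻¹, framedField Y (g * h⁻¹)) =
      frameMap H (g * h⁻¹, baseDeriv H h (framedField Y g)) := by
    rw [frameMap_framedField hπ, ← frameMap_mul hπ hh, inv_mul_cancel_right,
      frameMap_framedField hπ, h1]
  have h3 := congrArg (frameVec (g * h⁻¹)) h2
  rwa [frameVec_frameMap hπ (g * h⁻¹, _), frameVec_frameMap hπ (g * h⁻¹, _)] at h3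

theorem exists_baseDeriv_eq (hπ : Manifold.IsSubmersion 𝓘(ℝ, E) 𝓘(ℝ, F) ∞ (proj H)) (g : G)
    (w : F) : ∃ v : F, baseDeriv H g v = w :=
  ⟨_, congrArg fiberVec (frameMap_frameVec hπ g (fiberMk (proj H g) w) rfl)⟩

/-- The covariant derivative at `x` of a vector field with respect to the connection with
horizontal spaces `(L_g)_* b(T_o(G/H))`, computed at a chosen representative of `x`. -/
def horizontalDeriv (b : F →L[ℝ] E) (Y : ∀ x : G ⧸ H, TangentSpace 𝓘(ℝ, F) x) (x : G ⧸ H) :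
    F →L[ℝ] F :=
  baseDeriv H (Quotient.out x) ∘L modelDeriv 𝓘(ℝ, E) 𝓘(ℝ, F) (framedField Y) (Quotient.out x) ∘L
    leftDeriv (Quotient.out x) ∘L b ∘L
    modelDeriv 𝓘(ℝ, F) 𝓘(ℝ, F) (fun z : G ⧸ H ↦ (Quotient.out x)⁻¹ • z) x

/-- Independence of the representative: passing from `g` to `g h⁻¹` transforms `framedField Y` by
`h_*` and the horizontal direction by `Ad(h)`, and equivariance of `b` makes the two changes cancel.
-/
theorem horizontalDeriv_baseDeriv (hπ : Manifold.IsSubmersion 𝓘(ℝ, E) 𝓘(ℝ, F) ∞ (proj H))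
    {b : F →L[ℝ] E} (hb : IsHorizontalSection H b) {Y : ∀ x : G ⧸ H, TangentSpace 𝓘(ℝ, F) x}
    {g : G} (hY : MDifferentiableAt 𝓘(ℝ, F) 𝓘(ℝ, F).tangent
      (fun z ↦ (⟨z, Y z⟩ : TangentBundle 𝓘(ℝ, F) (G ⧸ H))) (proj H g)) (v : F) :
    horizontalDeriv b Y (proj H g) (baseDeriv H g v) =
      baseDeriv H g (modelDeriv 𝓘(ℝ, E) 𝓘(ℝ, F) (framedField Y) g (leftDeriv g (b v))) := by
  obtain ⟨k, hk⟩ : ∃ k : G, k = Quotient.out (proj H g) := ⟨_, rfl⟩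
  have hkg : proj H k = proj H g := by rw [hk]; exact Quotient.out_eq' _
  obtain ⟨h, hh, rfl⟩ : ∃ h ∈ H, k = g * h⁻¹ :=
    ⟨k⁻¹ * g, QuotientGroup.eq.1 hkg, by group⟩
  rw [horizontalDeriv, ← hk]
  have h1 : modelDeriv 𝓘(ℝ, F) 𝓘(ℝ, F) (fun z : G ⧸ H ↦ (g * h⁻¹)⁻¹ • z) (proj H g)
      (baseDeriv H g v) = baseDeriv H h v := by
    have h2 := frameMap_mul hπ hh (g * h⁻¹) v
    rw [inv_mul_cancel_right] at h2
    exact (congrArg (frameVec (g * h⁻¹)) h2).trans (frameVec_frameMap hπ (g * h⁻¹, baseDeriv H h v))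
  have hL := hasModelDerivAt_framedField hπ (hkg.symm ▸ hY)
  have h2 := HasModelDerivAt.comp_of_eq hL (hasModelDerivAt_mul_right (E := E) h⁻¹ g) rfl
  simp only [framedField_mul hπ Y hh] at h2
  have h3 := (baseDeriv H h).hasFDerivAt.hasModelDerivAt.comp (hasModelDerivAt_framedField hπ hY)
  have h4 := DFunLike.congr_fun (h2.unique h3) (leftDeriv g (b v))
  simp only [ContinuousLinearMap.comp_apply] at h4 ⊢
  rw [modelDeriv_mul_right_leftDeriv] at h4
  rw [h1, hb.equivariant h hh, h4, ← baseDeriv_mul hπ hh, inv_mul_cancel_right]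

/-- Existence of the Nomizu connection. -/
theorem exists_isNomizuConnection (hπ : Manifold.IsSubmersion 𝓘(ℝ, E) 𝓘(ℝ, F) ∞ (proj H))
    {b : F →L[ℝ] E} (hb : IsHorizontalSection H b) {𝔪 : Submodule ℝ (GroupLieAlgebra 𝓘(ℝ, E) G)}
    (hb𝔪 : ∀ ξ : E, ξ ∈ 𝔪 → b (projDeriv E H ξ) = ξ) :
    ∃ D : CovariantDerivative 𝓘(ℝ, F) F (TangentSpace 𝓘(ℝ, F) : G ⧸ H → Type _),
      IsNomizuConnection 𝔪 D := by
  -- The axioms of a covariant derivative concern sections differentiable at `x`, so the value on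
  -- other sections is immaterial.
  refine ⟨⟨fun Y x ↦ show F →L[ℝ] F from horizontalDeriv b Y x, ⟨?_, ?_⟩⟩, ?_⟩
  · intro σ τ x hσ hτ _
    obtain ⟨g, rfl⟩ := QuotientGroup.mk_surjective x
    refine ContinuousLinearMap.ext fun w ↦ ?_
    obtain ⟨v, rfl⟩ := exists_baseDeriv_eq hπ g w
    have h1 := (hasModelDerivAt_framedField hπ hσ).add (hasModelDerivAt_framedField hπ hτ)
    have h2 : (fun k ↦ framedField σ k + framedField τ k) = framedField (σ + τ) := by
      funext k
      exact (map_add (modelDeriv 𝓘(ℝ, F) 𝓘(ℝ, F) (fun x : G ⧸ H ↦ k⁻¹ • x) (proj H k))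
        (sectionMap σ (proj H k)).2 (sectionMap τ (proj H k)).2).symm
    rw [h2] at h1
    change horizontalDeriv b (σ + τ) (proj H g) (baseDeriv H g v) =
      horizontalDeriv b σ (proj H g) (baseDeriv H g v) +
      horizontalDeriv b τ (proj H g) (baseDeriv H g v)
    rw [horizontalDeriv_baseDeriv hπ hb (mdifferentiableAt_add_section hσ hτ),
      horizontalDeriv_baseDeriv hπ hb hσ, horizontalDeriv_baseDeriv hπ hb hτ, h1.modelDeriv,
      ← map_add]
    rfl
  · intro σ f x hσ hf _
    obtain ⟨g, rfl⟩ := QuotientGroup.mk_surjective x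
    refine ContinuousLinearMap.ext fun w ↦ ?_
    obtain ⟨v, rfl⟩ := exists_baseDeriv_eq hπ g w
    have h1 := (hf.hasModelDerivAt.comp (hasModelDerivAt_proj hπ g)).smul
      (hasModelDerivAt_framedField hπ hσ)
    have h2 : (fun k ↦ f (proj H k) • framedField σ k) = framedField (f • σ) := by
      funext k
      exact (map_smul (modelDeriv 𝓘(ℝ, F) 𝓘(ℝ, F) (fun x : G ⧸ H ↦ k⁻¹ • x) (proj H k))
        (f (proj H k)) (sectionMap σ (proj H k)).2).symm
    rw [h2] at h1
    change horizontalDeriv b (f • σ) (proj H g) (baseDeriv H g v) =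
      f (proj H g) • horizontalDeriv b σ (proj H g) (baseDeriv H g v) +
      modelDeriv 𝓘(ℝ, F) 𝓘(ℝ, ℝ) f (proj H g) (baseDeriv H g v) • fiberVec (sectionMap σ (proj H g))
    rw [horizontalDeriv_baseDeriv hπ hb (hf.smul_section hσ),
      horizontalDeriv_baseDeriv hπ hb hσ, h1.modelDeriv]
    simp only [add_apply, smul_apply, map_add, map_smul,
      ContinuousLinearMap.smulRight_apply, ContinuousLinearMap.comp_apply,
      modelDeriv_proj_leftDeriv hπ, hb.right_inv, baseDeriv_framedField hπ]
    rfl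
  · intro Y g hY ξ hξ
    obtain ⟨ξ', hξ'⟩ : ∃ ξ' : E, ξ' = ξ := ⟨ξ, rfl⟩
    have h1 := horizontalDeriv_baseDeriv hπ hb hY (projDeriv E H ξ')
    rw [hb𝔪 ξ' (hξ' ▸ hξ), ← modelDeriv_proj_leftDeriv hπ, hξ'] at h1
    exact h1

/-! ### Identification of `𝔪` with the tangent space at `o` -/

/-- The Lie algebra of the isotropy group is the kernel of the differential of the projection. -/
theorem mem_subgroupLieAlgebra_iff (hπ : Manifold.IsSubmersion 𝓘(ℝ, E) 𝓘(ℝ, F) ∞ (proj H))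
    (ξ : GroupLieAlgebra 𝓘(ℝ, E) G) :
    ξ ∈ subgroupLieAlgebra H ↔ projDeriv (F := F) E H (show E from ξ) = 0 := by
  constructor
  · rintro ⟨γ, hγ, hγ0, hγH, rfl⟩
    have h1 := HasModelDerivAt.comp_of_eq (hasModelDerivAt_proj hπ 1)
      (hγ.contMDiffAt (x := (0 : ℝ))).hasModelDerivAt hγ0
    have h2 : (fun t ↦ proj H (γ t)) = fun _ ↦ proj H 1 := funext fun t ↦ proj_of_mem (hγH t)
    rw [h2] at h1
    exact DFunLike.congr_fun (h1.unique (hasModelDerivAt_const (proj H 1) (0 : ℝ))) (1 : ℝ)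
  · intro hξ
    obtain ⟨γ, hγ, hγ0, hγπ, hγξ⟩ := exists_curve_in_fiber (hπ.isSubmersionAt 1) hξ
    refine ⟨γ, hγ, hγ0, fun t ↦ ?_, hγξ⟩
    have h := QuotientGroup.eq.1 (hγπ t).symm
    rwa [inv_one, one_mul] at h

/-- The identification of `𝔪` with the tangent space at the base point. -/
theorem exists_equiv_projDeriv (hπ : Manifold.IsSubmersion 𝓘(ℝ, E) 𝓘(ℝ, F) ∞ (proj H))
    {𝔪 : Submodule ℝ (GroupLieAlgebra 𝓘(ℝ, E) G)} (h𝔪 : IsCompl (subgroupLieAlgebra H) 𝔪) :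
    ∃ B : 𝔪 ≃ₗ[ℝ] F, ∀ y : 𝔪, B y = projDeriv (F := F) E H y.1 := by
  let P : GroupLieAlgebra 𝓘(ℝ, E) G →ₗ[ℝ] F := (projDeriv (F := F) E H : E →ₗ[ℝ] F)
  have hker : LinearMap.ker P = subgroupLieAlgebra H := by
    ext ξ
    exact (mem_subgroupLieAlgebra_iff hπ ξ).symm
  have hP : ∀ v, ∃ ξ, P ξ = v := fun v ↦ mfderiv_surjective_of_submersion (hπ.isSubmersionAt 1) v
  have hinj : Function.Injective (P ∘ₗ 𝔪.subtype) := by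
    rw [← LinearMap.ker_eq_bot, LinearMap.ker_comp, hker, ← Submodule.disjoint_iff_comap_eq_bot]
    exact h𝔪.disjoint.symm
  have hsurj : Function.Surjective (P ∘ₗ 𝔪.subtype) := by
    intro v
    obtain ⟨ξ, rfl⟩ := hP v
    obtain ⟨a, ha, y, hy, rfl⟩ := Submodule.mem_sup.1
      (h𝔪.sup_eq_top ▸ Submodule.mem_top : ξ ∈ subgroupLieAlgebra H ⊔ 𝔪)
    rw [← hker, LinearMap.mem_ker] at ha
    exact ⟨⟨y, hy⟩, by rw [map_add, ha, zero_add]; rfl⟩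
  exact ⟨LinearEquiv.ofBijective _ ⟨hinj, hsurj⟩, fun y ↦ rfl⟩

theorem contDiff_linearEquiv {V : Type*} [NormedAddCommGroup V] [NormedSpace ℝ V]
    [FiniteDimensional ℝ F] (B : V ≃ₗ[ℝ] F) : ContDiff ℝ ∞ B ∧ ContDiff ℝ ∞ B.symm := by
  have : FiniteDimensional ℝ V := B.symm.finiteDimensional
  exact ⟨B.toContinuousLinearEquiv.contDiff, B.symm.toContinuousLinearEquiv.contDiff⟩

variable {𝔪 : Submodule ℝ (GroupLieAlgebra 𝓘(ℝ, E) G)} {B : 𝔪 ≃ₗ[ℝ] F}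

/-- The inclusion of `𝔪 = T_o(G/H)` into the Lie algebra. -/
def horizontalLift [FiniteDimensional ℝ F] (B : 𝔪 ≃ₗ[ℝ] F) : F →L[ℝ] E :=
  LinearMap.toContinuousLinearMap
    (show F →ₗ[ℝ] E from 𝔪.subtype ∘ₗ (B.symm : F →ₗ[ℝ] 𝔪))

theorem equiv_ad (hπ : Manifold.IsSubmersion 𝓘(ℝ, E) 𝓘(ℝ, F) ∞ (proj H))
    (hB : ∀ y : 𝔪, B y = projDeriv (F := F) E H y.1) {h : G} (hh : h ∈ H) {y z : 𝔪}
    (hz : z.1 = Ad h y.1) : B z = baseDeriv H h (B y) := by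
  rw [hB, hB]
  exact (congrArg (projDeriv E H) hz).trans (projDeriv_adDeriv hπ hh y.1)

theorem isHorizontalSection_horizontalLift [FiniteDimensional ℝ F]
    (hπ : Manifold.IsSubmersion 𝓘(ℝ, E) 𝓘(ℝ, F) ∞ (proj H)) (h𝔪 : IsReductiveDecomposition H 𝔪)
    (hB : ∀ y : 𝔪, B y = projDeriv (F := F) E H y.1) :
    IsHorizontalSection H (horizontalLift B) := by
  refine ⟨fun v ↦ (hB (B.symm v)).symm.trans (B.apply_symm_apply v), fun h hh v ↦ ?_⟩
  have h1 := equiv_ad hπ hB hh (y := B.symm v) (z := ⟨_, h𝔪.ad_mem h hh _ (B.symm v).2⟩) rfl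
  rw [B.apply_symm_apply] at h1
  exact congrArg Subtype.val ((congrArg B.symm h1.symm).trans (B.symm_apply_apply _))

/-- Transport along the linear isomorphism `B`, which is smooth in both directions and intertwines
`Ad(H)` on `𝔪` with the isotropy representation. -/
theorem isInvariantHomogeneousMap_iff [FiniteDimensional ℝ F]
    (hπ : Manifold.IsSubmersion 𝓘(ℝ, E) 𝓘(ℝ, F) ∞ (proj H)) (h𝔪 : IsReductiveDecomposition H 𝔪)
    (hB : ∀ y : 𝔪, B y = projDeriv (F := F) E H y.1) {η : 𝔪 → 𝔪} {ζ : F → F}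
    (hηζ : ∀ y, B (η y) = ζ (B y)) :
    IsInvariantHomogeneousMap H 𝔪 η ↔ IsIsotropyInvariant H ζ := by
  have hB0 : ∀ y : 𝔪, y ≠ 0 ↔ B y ≠ 0 := fun y ↦ (B.map_ne_zero_iff).symm
  have hη : ∀ y, η y = B.symm (ζ (B y)) := fun y ↦ by rw [← hηζ, B.symm_apply_apply]
  have hζ : ∀ v, ζ v = B (η (B.symm v)) := fun v ↦ by rw [hηζ, B.apply_symm_apply]
  constructor
  · intro h
    refine ⟨?_, ?_, fun r hr v hv ↦ ?_, fun k hk v hv ↦ ?_⟩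
    · refine ((contDiff_linearEquiv B).1.comp_contDiffOn (h.smooth.comp
        (contDiff_linearEquiv B).2.contDiffOn (s := {0}ᶜ) fun v hv ↦ ?_)).congr fun v _ ↦ hζ v
      exact (B.symm.map_ne_zero_iff).2 hv
    · rw [hζ, map_zero, h.zero_off, map_zero]
    · rw [hζ, hζ, map_smul, h.homogeneous r hr _ ((B.symm.map_ne_zero_iff).2 hv), map_smul]
    · obtain ⟨y, rfl⟩ := B.surjective v
      have h1 := equiv_ad hπ hB hk (y := y) (z := ⟨_, h𝔪.ad_mem k hk _ y.2⟩) rfl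
      rw [← h1, ← hηζ, ← hηζ]
      exact equiv_ad hπ hB hk (h.ad_invariant k hk y _ ((hB0 y).2 hv) rfl)
  · intro h
    refine ⟨?_, ?_, fun r hr y hy ↦ ?_, fun k hk y z hy hz ↦ ?_⟩
    · refine ((contDiff_linearEquiv B).2.comp_contDiffOn (h.smooth.comp
        (contDiff_linearEquiv B).1.contDiffOn (s := {0}ᶜ) fun y hy ↦ ?_)).congr fun y _ ↦ hη y
      exact (hB0 y).1 hy
    · rw [hη, map_zero, h.zero_off, map_zero]
    · rw [hη, hη, map_smul, h.homogeneous r hr _ ((hB0 y).1 hy), map_smul]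
    · have h1 := equiv_ad hπ hB hk (y := η y) (z := ⟨_, h𝔪.ad_mem k hk _ (η y).2⟩) rfl
      refine congrArg Subtype.val (B.injective (Eq.trans ?_ h1.symm))
      rw [hηζ, hηζ, equiv_ad hπ hB hk hz, h.invariant k hk _ ((hB0 y).1 hy)]

/-! ### Computation of the spray vector field -/

section SprayVectorField

variable [FiniteDimensional ℝ F] {ζ : F → F} {W : TangentBundleField F (G ⧸ H)}

theorem IsRelatedField.hasDerivAt_leftVelocity
    (hπ : Manifold.IsSubmersion 𝓘(ℝ, E) 𝓘(ℝ, F) ∞ (proj H))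
    (hB : ∀ y : 𝔪, B y = projDeriv (F := F) E H y.1)
    (hW : IsRelatedField (horizontalLift B) ζ W) {y : 𝔪} (hy : y ≠ 0)
    {c : ℝ → G ⧸ H} {γ : ℝ → G} (h : IsGeodesicLift 𝔪 W y c γ) :
    HasDerivAt (leftVelocity γ) (-(B.symm (ζ (B y))).1) 0 := by
  have hb : ∀ ξ : E, ξ ∈ 𝔪 → horizontalLift B (projDeriv E H ξ) = ξ := fun ξ hξ ↦
    congrArg Subtype.val
      ((congrArg B.symm (hB ⟨ξ, hξ⟩).symm).trans (B.symm_apply_apply ⟨ξ, hξ⟩))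
  have h1 := SprayGeometry.hasDerivAt_leftVelocity hπ hb hW
    (by rw [← hB]; exact (B.map_ne_zero_iff).2 hy) h
  rw [← hB] at h1
  exact h1

theorem IsRelatedField.exists_isGeodesicLift [FiniteDimensional ℝ E]
    (hπ : Manifold.IsSubmersion 𝓘(ℝ, E) 𝓘(ℝ, F) ∞ (proj H)) (h𝔪 : IsReductiveDecomposition H 𝔪)
    (hB : ∀ y : 𝔪, B y = projDeriv (F := F) E H y.1) (hζ : ContDiffOn ℝ ∞ ζ {0}ᶜ)
    (hW : IsRelatedField (horizontalLift B) ζ W) {y : 𝔪} (hy : y ≠ 0) :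
    ∃ c γ, IsGeodesicLift 𝔪 W y c γ := by
  have := FiniteDimensional.complete ℝ E
  have := FiniteDimensional.complete ℝ F
  exact SprayGeometry.exists_isGeodesicLift hπ (isHorizontalSection_horizontalLift hπ h𝔪 hB)
    (fun v ↦ (B.symm v).2) hζ hW y (by rw [← hB]; exact (B.map_ne_zero_iff).2 hy)

theorem sprayVectorField_zero (W : TangentBundleField F (G ⧸ H)) : sprayVectorField 𝔪 W 0 = 0 :=
  dif_neg fun ⟨_, h, _⟩ ↦ h rfl

theorem IsRelatedField.sprayVectorField_eq [FiniteDimensional ℝ E]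
    (hπ : Manifold.IsSubmersion 𝓘(ℝ, E) 𝓘(ℝ, F) ∞ (proj H)) (h𝔪 : IsReductiveDecomposition H 𝔪)
    (hB : ∀ y : 𝔪, B y = projDeriv (F := F) E H y.1) (hζ : ContDiffOn ℝ ∞ ζ {0}ᶜ) (hζ0 : ζ 0 = 0)
    (hW : IsRelatedField (horizontalLift B) ζ W) (y : 𝔪) :
    sprayVectorField 𝔪 W y = B.symm (ζ (B y)) := by
  by_cases hy : y = 0
  · rw [hy, sprayVectorField_zero, map_zero, hζ0, map_zero]
  obtain ⟨c, γ, hγ⟩ := hW.exists_isGeodesicLift hπ h𝔪 hB hζ hy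
  have hex : ∃ w : 𝔪, y ≠ 0 ∧ ∃ c γ, IsGeodesicLift 𝔪 W y c γ ∧
      HasDerivAt (leftVelocity γ) (w : GroupLieAlgebra 𝓘(ℝ, E) G) 0 :=
    ⟨-B.symm (ζ (B y)), hy, c, γ, hγ, hW.hasDerivAt_leftVelocity hπ hB hy hγ⟩
  refine (dif_pos hex).trans ?_
  -- The chosen value may come from another lift, but all lifts have the same derivative at `0`.
  obtain ⟨-, c', γ', hγ', hd⟩ := hex.choose_spec
  have h1 := hd.unique (hW.hasDerivAt_leftVelocity hπ hB hy hγ')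
  rw [neg_eq_iff_eq_neg]
  exact Subtype.ext h1

end SprayVectorField

/-! ### Differences of invariant fields -/

theorem IsSlitField.sub {M : Type*} [TopologicalSpace M] [ChartedSpace F M]
    [IsManifold 𝓘(ℝ, F) ∞ M] {V W : TangentBundleField F M} (hV : IsSlitField V)
    (hW : IsSlitField W) : IsSlitField (V - W) :=
  ⟨hV.smooth.sub_section hW.smooth, fun p hp ↦ by
    rw [Pi.sub_apply, hV.zero_off p hp, hW.zero_off p hp]; exact sub_zero (0 : F × F)⟩

theorem IsInvariantField.sub {V W : TangentBundleField F (G ⧸ H)} (hV : IsInvariantField G V)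
    (hW : IsInvariantField G W) : IsInvariantField G (V - W) := by
  intro g p hp
  exact (map_sub (modelDeriv 𝓘(ℝ, F).tangent 𝓘(ℝ, F).tangent (push g) p) (fieldVec V p)
    (fieldVec W p)).trans (congrArg₂ (fun a b : F × F ↦ a - b) (hV g p hp) (hW g p hp))

/-- The horizontal entries of the two lifted fields coincide and cancel, leaving `(0, ζ(v))`. -/
theorem IsRelatedField.fieldVec_sub (hπ : Manifold.IsSubmersion 𝓘(ℝ, E) 𝓘(ℝ, F) ∞ (proj H))
    {b : F →L[ℝ] E} {ζ : F → F} {W₀ W : TangentBundleField F (G ⧸ H)}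
    (hW₀ : IsRelatedField b 0 W₀) (hW : IsRelatedField b ζ W) {q : G × F} (hq : q.2 ≠ 0) :
    fieldVec (W₀ - W) (frameMap H q) =
      verticalLift (frameMap H q) (baseDeriv H q.1 (ζ q.2) : F) := by
  change fieldVec W₀ (frameMap H q) - fieldVec W (frameMap H q) = _
  rw [hW₀ q hq, hW q hq, ← map_sub, ← frameDeriv_vertical hπ]
  simp [frameField]

theorem IsRelatedField.isVerticalField_sub
    (hπ : Manifold.IsSubmersion 𝓘(ℝ, E) 𝓘(ℝ, F) ∞ (proj H))
    {b : F →L[ℝ] E} {ζ : F → F} {W₀ W : TangentBundleField F (G ⧸ H)}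
    (hW₀ : IsRelatedField b 0 W₀) (hW : IsRelatedField b ζ W)
    (hs₀ : IsSlitField W₀) (hs : IsSlitField W) : IsVerticalField (W₀ - W) := by
  refine ⟨hs₀.sub hs, fun p hp ↦ ?_⟩
  obtain ⟨q, rfl⟩ := exists_frameMap_eq hπ p
  exact ⟨_, hW₀.fieldVec_sub hπ hW ((frameMap_mem_slit hπ).1 hp)⟩

/-- Invariant fields are determined by their restriction to the tangent space at the base point. -/
theorem IsInvariantField.eq (hπ : Manifold.IsSubmersion 𝓘(ℝ, E) 𝓘(ℝ, F) ∞ (proj H))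
    {V W : TangentBundleField F (G ⧸ H)} (hV : IsInvariantField G V) (hW : IsInvariantField G W)
    (hV0 : ∀ p, p ∉ slit F (G ⧸ H) → V p = 0) (hW0 : ∀ p, p ∉ slit F (G ⧸ H) → W p = 0)
    (h : ∀ v : F, v ≠ 0 → fieldVec V (fiberMk (proj H 1) v) = fieldVec W (fiberMk (proj H 1) v)) :
    V = W := by
  funext p
  by_cases hp : p ∈ slit F (G ⧸ H)
  · obtain ⟨q, rfl⟩ := exists_frameMap_eq hπ p
    have hq := (frameMap_mem_slit hπ).1 hp
    have hq1 : fiberMk (proj H 1) q.2 ∈ slit F (G ⧸ H) := hq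
    change fieldVec V _ = fieldVec W _
    rw [frameMap_eq_push, hV.fieldVec_push q.1 hq1, hW.fieldVec_push q.1 hq1, h _ hq]
  · rw [hV0 p hp, hW0 p hp]

end Homogeneous

end SprayGeometry
end

theorem theorem5p5 {E F G : Type*}
    [NormedAddCommGroup E] [NormedSpace ℝ E] [FiniteDimensional ℝ E]
    [NormedAddCommGroup F] [NormedSpace ℝ F] [FiniteDimensional ℝ F]
    [TopologicalSpace G] [ChartedSpace E G] [Group G] [LieGroup 𝓘(ℝ, E) ∞ G]
    (H : Subgroup G) [ChartedSpace F (G ⧸ H)] [IsManifold 𝓘(ℝ, F) ∞ (G ⧸ H)]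
    (hπ : Manifold.IsSubmersion 𝓘(ℝ, E) 𝓘(ℝ, F) ∞ (proj H))
    (𝔪 : Submodule ℝ (GroupLieAlgebra 𝓘(ℝ, E) G)) (h𝔪 : IsReductiveDecomposition H 𝔪) :
    -- the spray vector field of an invariant spray structure is well defined
    (∀ W : TangentBundleField F (G ⧸ H), IsSpray W → IsInvariantField G W →
      ∀ y : 𝔪, y ≠ 0 →
        (∃ c γ, IsGeodesicLift 𝔪 W y c γ) ∧
        ∀ c γ, IsGeodesicLift 𝔪 W y c γ →
          HasDerivAt (leftVelocity γ)
            (-(sprayVectorField 𝔪 W y : GroupLieAlgebra 𝓘(ℝ, E) G)) 0) ∧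
    -- the correspondence
    Set.BijOn (sprayVectorField 𝔪)
      {W : TangentBundleField F (G ⧸ H) | IsSpray W ∧ IsInvariantField G W}
      {η : 𝔪 → 𝔪 | IsInvariantHomogeneousMap H 𝔪 η} ∧
    -- the decomposition with respect to the spray structure of the Nomizu connection
    (∃ D : CovariantDerivative 𝓘(ℝ, F) F (TangentSpace 𝓘(ℝ, F) : G ⧸ H → Type _),
      IsNomizuConnection 𝔪 D) ∧
    ∀ D : CovariantDerivative 𝓘(ℝ, F) F (TangentSpace 𝓘(ℝ, F) : G ⧸ H → Type _),
      IsNomizuConnection 𝔪 D →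
      ∃ W₀ : TangentBundleField F (G ⧸ H),
        IsSpray W₀ ∧ IsGeodesicSprayOf D W₀ ∧
        (∀ W', IsSpray W' → IsGeodesicSprayOf D W' → W' = W₀) ∧
        IsInvariantField G W₀ ∧ sprayVectorField 𝔪 W₀ = 0 ∧
        ∀ W : TangentBundleField F (G ⧸ H), IsSpray W → IsInvariantField G W →
          ∃ V : TangentBundleField F (G ⧸ H),
            IsVerticalField V ∧ IsInvariantField G V ∧ W = W₀ - V ∧
            (∀ V', IsVerticalField V' → IsInvariantField G V' → W = W₀ - V' → V' = V) ∧
            RestrictsTo 𝔪 V (sprayVectorField 𝔪 W) ∧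
            (∀ V', IsVerticalField V' → IsInvariantField G V' →
              RestrictsTo 𝔪 V' (sprayVectorField 𝔪 W) → V' = V) := by
  obtain ⟨B, hB⟩ := exists_equiv_projDeriv hπ h𝔪.isCompl
  have hb := isHorizontalSection_horizontalLift hπ h𝔪 hB
  -- `ζ = 0` induces the field that serves as geodesic spray of the Nomizu connection.
  have hζ0 : IsIsotropyInvariant H (0 : F → F) :=
    ⟨contDiffOn_const, rfl, fun _ _ _ _ ↦ (smul_zero _).symm, fun h _ _ _ ↦
      (map_zero (baseDeriv (F := F) H h)).symm⟩
  have hrel₀ := isRelatedField_inducedField hπ hb hζ0.invariant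
  have hspray₀ := hrel₀.isSpray hπ hb hζ0 (inducedField_zero_off _ _)
  have hspray : ∀ W : TangentBundleField F (G ⧸ H), IsSpray W → IsInvariantField G W →
      ∃ ζ : F → F, IsIsotropyInvariant H ζ ∧ IsRelatedField (horizontalLift B) ζ W ∧
        ∀ y, sprayVectorField 𝔪 W y = B.symm (ζ (B y)) := by
    intro W hW hWi
    obtain ⟨ζ, hζ, hrel⟩ := exists_isRelatedField hb hπ hW hWi
    exact ⟨ζ, hζ, hrel, hrel.sprayVectorField_eq hπ h𝔪 hB hζ.smooth hζ.zero_off⟩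
  refine ⟨?_, ⟨?_, ?_, ?_⟩, ?_, ?_⟩
  · intro W hW hWi y hy
    obtain ⟨ζ, hζ, hrel, hη⟩ := hspray W hW hWi
    refine ⟨hrel.exists_isGeodesicLift hπ h𝔪 hB hζ.smooth hy, fun c γ h ↦ ?_⟩
    rw [hη]
    exact hrel.hasDerivAt_leftVelocity hπ hB hy h
  · rintro W ⟨hW, hWi⟩
    obtain ⟨ζ, hζ, hrel, hη⟩ := hspray W hW hWi
    exact (isInvariantHomogeneousMap_iff hπ h𝔪 hB fun y ↦ by
      rw [hη, B.apply_symm_apply]).2 hζ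
  · rintro W ⟨hW, hWi⟩ W' ⟨hW', hWi'⟩ h
    obtain ⟨ζ, hζ, hrel, hη⟩ := hspray W hW hWi
    obtain ⟨ζ', hζ', hrel', hη'⟩ := hspray W' hW' hWi'
    have hζζ' : ζ = ζ' := by
      funext v
      have h1 := congrFun h (B.symm v)
      rwa [hη, hη', B.apply_symm_apply, B.symm.injective.eq_iff] at h1
    subst hζζ'
    exact hrel.eq hπ hrel' hW.zero_off hW'.zero_off
  · intro η hη
    obtain ⟨ζ, hηζ⟩ : ∃ ζ : F → F, ∀ y, B (η y) = ζ (B y) :=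
      ⟨fun v ↦ B (η (B.symm v)), fun y ↦ by simp⟩
    have hζ := (isInvariantHomogeneousMap_iff hπ h𝔪 hB hηζ).1 hη
    have hrel := isRelatedField_inducedField hπ hb hζ.invariant
    refine ⟨_, ⟨hrel.isSpray hπ hb hζ (inducedField_zero_off _ _), hrel.isInvariantField hπ⟩, ?_⟩
    funext y
    rw [hrel.sprayVectorField_eq hπ h𝔪 hB hζ.smooth hζ.zero_off, ← hηζ, B.symm_apply_apply]
  · exact exists_isNomizuConnection hπ hb fun ξ hξ ↦ congrArg Subtype.val
      ((congrArg B.symm (hB ⟨ξ, hξ⟩).symm).trans (B.symm_apply_apply ⟨ξ, hξ⟩))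
  · intro D hD
    have hgeo := hD.isGeodesicSprayOf hπ hb (fun v ↦ (B.symm v).2) hrel₀
    refine ⟨inducedField H (horizontalLift B) 0, hspray₀, hgeo,
      fun W' hW' h ↦ h.eq hgeo hW'.zero_off (inducedField_zero_off _ _),
      hrel₀.isInvariantField hπ, ?_, fun W hW hWi ↦ ?_⟩
    · funext y
      rw [hrel₀.sprayVectorField_eq hπ h𝔪 hB hζ0.smooth hζ0.zero_off]
      exact map_zero B.symm
    · obtain ⟨ζ, hζ, hrel, hη⟩ := hspray W hW hWi
      have hvert := hrel₀.isVerticalField_sub hπ hrel hspray₀.toIsSlitField hW.toIsSlitField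
      have hinv := (hrel₀.isInvariantField hπ).sub hWi
      have hres : RestrictsTo 𝔪 (inducedField H (horizontalLift B) 0 - W)
          (sprayVectorField 𝔪 W) := by
        intro y hy
        -- At `g = 1` the frame is the identity, so the difference is the vertical lift of `ζ (B y)`
        -- itself.
        have h1 := hrel₀.fieldVec_sub hπ hrel (q := (1, B y)) ((B.map_ne_zero_iff).2 hy)
        have h2 : ζ (B y) = B (sprayVectorField 𝔪 W y) := by rw [hη, B.apply_symm_apply]
        rw [frameMap_one, baseDeriv_one, h2, hB, hB] at h1
        exact h1
      refine ⟨_, hvert, hinv, (sub_sub_cancel _ W).symm, fun V' _ _ hV' ↦ ?_, hres,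
        fun V' hV' hVi' hres' ↦ hVi'.eq hπ hinv hV'.zero_off hvert.zero_off fun v hv ↦ ?_⟩
      · rw [hV', sub_sub_cancel]
      · obtain ⟨y, rfl⟩ := B.surjective v
        have hy := (B.map_ne_zero_iff).1 hv
        have h1 := (hres' y hy).trans (hres y hy).symm
        rw [hB]
        exact h1
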